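/- **Setting.** Let $(\Omega,\mathcal F)$ be a measurable space. Let $C_{l,Lip}(\mathbb R^n)$ be the set of functions $\varphi:\mathbb R^n\to\mathbb R$ with $|\varphi(x)-\varphi(y)|\le C(1+|x|^m+|y|^m)|x-y|$ for all $x,y$, for some $C>0$, $m\in\mathbb N$ depending on $\varphi$. Let $\mathscr H$ be a linear space of real $\mathcal F$-measurable functions on $\Omega$ such that $\varphi(X_1,\dots,X_n)\in\mathscr H$ whenever $X_1,\dots,X_n\in\mathscr H$ and $\varphi\in C_{l,Lip}(\mathbb R^n)$, and let $\mathbb E:\mathscr H\to[-\infty,\infty]$ be a sub-linear expectation: it is monotone, $\mathbb E[c]=c$ for constants, $\mathbb E[X+Y]\le\mathbb E[X]+\mathbb E[Y]$ whenever the right side is not of the form $\infty-\infty$, and $\mathbb E[\lambda X]=\lambda\mathbb E[X]$ for $\lambda\ge0$. Put $\mathcal E[X]=-\mathbb E[-X]$ and $$\mathbb V(A)=\inf\{\mathbb E[\xi]:\ I_A\le\xi,\ \xi\in\mathscr H\},\qquad C_{\mathbb V}[X]=\int_0^\infty\mathbb V(X\ge t)\,dt+\int_{-\infty}^0[\mathbb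 V(X\ge t)-1]\,dt .$$ The capacity $\mathbb V$ is *continuous* if $\mathbb V(A_n)\to\mathbb V(A)$ whenever $A_n\uparrow A$ or $A_n\downarrow A$ in $\mathcal F$. Random variables $X,Y\in\mathscr H$ are *identically distributed* if $\mathbb E[\varphi(X)]=\mathbb E[\varphi(Y)]$ for all $\varphi\in C_{l,Lip}(\mathbb R)$ for which both are finite. Random variables $Y_1,\dots,Y_n\in\mathscr H$ ($n\ge 2$) are *extended independent* if $\mathbb E[\prod_{i=1}^n\psi_i(Y_i)]=\prod_{i=1}^n\mathbb E[\psi_i(Y_i)]$ for all non-negative $\psi_1,\dots,\psi_n\in C_{l,Lip}(\mathbb R)$ for which the sub-linear expectations involved are finite; a sequence is extended independent if its first $n$ terms are, for every $n\ge2$. **Statement.** Let $\{X_n;n\ge1\}\subset\mathscr H$ be extended independent and identically distributed (each $X_n$ is identically distributed with $X_1$), with $C_{\mathbb V}[|X_1|]<\infty$ and $\lim_{c\to\infty}\mathbb E[(|X_1|-c)^+]=0$, and suppose that $\mathbb V$ is continuous. Let $S_n=\sum_{k=1}^nX_k$. Then $$\mathbb V\Big(\liminf_{n\to\infty}\frac{S_n}n=\mathcal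 E[X_1]\Big)=1\quad\text{and}\quad\mathbb V\Big(\limsup_{n\to\infty}\frac{S_n}n=\mathbb E[X_1]\Big)=1 .$$ Moreover, if there is a sequence of integers $n_k\to\infty$ with $n_{k-1}/n_k\to0$ such that, for each $k$, $S_{n_{k-1}}$ and $S_{n_k}-S_{n_{k-1}}$ are extended independent, then $$\mathbb V\Big(\liminf_{n\to\infty}\frac{S_n}n=\mathcal E[X_1]\ \text{ and }\ \limsup_{n\to\infty}\frac{S_n}n=\mathbb E[X_1]\Big)=1$$ and $$\mathbb V\Big(C\Big\{\frac{S_n}n\Big\}=\big[\mathcal E[X_1],\mathbb E[X_1]\big]\Big)=1,$$ where $C\{x_n\}$ denotes the set of cluster points in $\mathbb R$ of the sequence $(x_n)$. -/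

import Mathlib

open Filter Topology MeasureTheory
open scoped ENNReal

/-- The class `C_{l,Lip}` of local Lipschitz functions:
`|φ x - φ y| ≤ C (1 + |x|^m + |y|^m) |x - y|` for some `C > 0` and `m ∈ ℕ` depending on `φ`.
On `ℝⁿ = Fin n → ℝ` equivalent norms give the same class. -/
def LocLip {F : Type*} [NormedAddCommGroup F] (φ : F → ℝ) : Prop :=
  ∃ C : ℝ, 0 < C ∧ ∃ m : ℕ, ∀ x y : F,
    |φ x - φ y| ≤ C * (1 + ‖x‖ ^ m + ‖y‖ ^ m) * ‖x - y‖

/-- A sub-linear expectation space over the measurable space `Ω`: a linear space `H` of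
(measurable) real functions on `Ω`, stable under composition with functions in `C_{l,Lip}(ℝⁿ)`,
and a sub-linear expectation `E` on `H` with values in `[-∞, ∞]`. All the laws, and all the
notions below, only concern the values of `E` on `H`; its values elsewhere play no role. -/
structure SubLinearExpectation (Ω : Type*) [MeasurableSpace Ω] where
  /-- the space of random variables -/
  H : Submodule ℝ (Ω → ℝ)
  /-- the sub-linear expectation -/
  E : (Ω → ℝ) → EReal
  measurable_of_mem : ∀ X ∈ H, Measurable X
  comp_mem : ∀ (n : ℕ) (X : Fin n → Ω → ℝ) (φ : (Fin n → ℝ) → ℝ),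
    (∀ i, X i ∈ H) → LocLip φ → (fun ω => φ (fun i => X i ω)) ∈ H
  mono : ∀ X ∈ H, ∀ Y ∈ H, (∀ ω, Y ω ≤ X ω) → E Y ≤ E X
  const : ∀ c : ℝ, E (fun _ => c) = (c : EReal)
  subadd : ∀ X ∈ H, ∀ Y ∈ H, ¬ (E X = ⊤ ∧ E Y = ⊥) → ¬ (E X = ⊥ ∧ E Y = ⊤) →
    E (fun ω => X ω + Y ω) ≤ E X + E Y
  pos_homog : ∀ X ∈ H, ∀ l : ℝ, 0 ≤ l → E (fun ω => l * X ω) = (l : EReal) * E X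

namespace SubLinearExpectation

variable {Ω : Type*} [MeasurableSpace Ω] (S : SubLinearExpectation Ω)

/-- The conjugate expectation `ℰ[X] = -E[-X]`. -/
noncomputable def conjE (X : Ω → ℝ) : EReal := - S.E (fun ω => - X ω)

/-- The upper capacity `V(A) = inf {E[ξ] : I_A ≤ ξ, ξ ∈ H}`; the infimum is taken in
`[-∞, ∞]`, and always lies in `[0, 1]`. -/
noncomputable def capacity (A : Set Ω) : EReal :=
  sInf {e : EReal | ∃ ξ ∈ S.H, (∀ ω, A.indicator (fun _ => (1 : ℝ)) ω ≤ ξ ω) ∧ e = S.E ξ}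

/-- `V` is a continuous capacity: continuous from below and from above along monotone
sequences of measurable sets. -/
def CapacityContinuous : Prop :=
  (∀ A : ℕ → Set Ω, (∀ n, MeasurableSet (A n)) → Monotone A →
    Tendsto (fun n => S.capacity (A n)) atTop (𝓝 (S.capacity (⋃ n, A n)))) ∧
  (∀ A : ℕ → Set Ω, (∀ n, MeasurableSet (A n)) → Antitone A →
    Tendsto (fun n => S.capacity (A n)) atTop (𝓝 (S.capacity (⋂ n, A n))))

/-- The Choquet integral
`C_V[X] = ∫_0^∞ V(X ≥ t) dt + ∫_{-∞}^0 (V(X ≥ t) - 1) dt`, in `[-∞, ∞]`, written as a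
difference of two integrals of non-negative functions. -/
noncomputable def choquet (X : Ω → ℝ) : EReal :=
  ((∫⁻ t in Set.Ioi (0 : ℝ), (S.capacity {ω | t ≤ X ω}).toENNReal : ℝ≥0∞) : EReal) -
    ((∫⁻ t in Set.Iio (0 : ℝ), (1 - S.capacity {ω | t ≤ X ω}).toENNReal : ℝ≥0∞) : EReal)

/-- `X` and `Y` are identically distributed: `E[φ(X)] = E[φ(Y)]` for all `φ ∈ C_{l,Lip}(ℝ)`
whenever both sub-linear expectations are finite. -/
def IdentDist (X Y : Ω → ℝ) : Prop :=
  ∀ φ : ℝ → ℝ, LocLip φ →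
    S.E (fun ω => φ (X ω)) ≠ ⊤ → S.E (fun ω => φ (X ω)) ≠ ⊥ →
    S.E (fun ω => φ (Y ω)) ≠ ⊤ → S.E (fun ω => φ (Y ω)) ≠ ⊥ →
    S.E (fun ω => φ (X ω)) = S.E (fun ω => φ (Y ω))

/-- The product formula of extended independence for a finite family `Y`:
`E[∏ ψᵢ(Yᵢ)] = ∏ E[ψᵢ(Yᵢ)]` for all non-negative `ψᵢ ∈ C_{l,Lip}(ℝ)`, whenever the (non-negative)
sub-linear expectations involved are finite. -/
def ExtIndepFamily {n : ℕ} (Y : Fin n → Ω → ℝ) : Prop :=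
  ∀ ψ : Fin n → ℝ → ℝ, (∀ i, LocLip (ψ i)) → (∀ i x, 0 ≤ ψ i x) →
    (∀ i, S.E (fun ω => ψ i (Y i ω)) ≠ ⊤) →
    S.E (fun ω => ∏ i, ψ i (Y i ω)) ≠ ⊤ →
    S.E (fun ω => ∏ i, ψ i (Y i ω)) = ∏ i, S.E (fun ω => ψ i (Y i ω))

/-- Extended independence of a sequence. -/
def ExtIndep (X : ℕ → Ω → ℝ) : Prop :=
  ∀ n : ℕ, 2 ≤ n → S.ExtIndepFamily (fun i : Fin n => X i)

/-- Extended independence of two random variables. -/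
def ExtIndepPair (Y Z : Ω → ℝ) : Prop :=
  S.ExtIndepFamily ![Y, Z]

end SubLinearExpectation

/-- The partial sums of a sequence: `partialSum X n` is the sum of its first `n` terms. -/
def partialSum {Ω : Type*} (X : ℕ → Ω → ℝ) (n : ℕ) (ω : Ω) : ℝ :=
  ∑ i ∈ Finset.range n, X i ω

/-- The cluster set in `ℝ` of a real sequence. -/
def clusterSet (x : ℕ → ℝ) : Set ℝ := {p | MapClusterPt p atTop x}

/-!
The argument rests on two one-sided statements about `S_n = partialSum X n`, each of which is also
applied to `-X`, and on the continuity of the capacity.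

*Upper half* (`cap_not_eventually_sum_le`, `cap_not_meanUpperBound`): `limsup S_n / n ≤ E[X 0]`
outside a set of capacity zero. Replacing `X i` by `max (X i) (-c) + c ≥ 0` makes the sums monotone
in `n`, so that it is enough to consider the indices `m * 2 ^ k` for each fixed `m ≥ 1`. There the
variables are truncated at a multiple of `m * 2 ^ k`. Extended independence factorizes exponential
moments, and the exponential Chebyshev inequality with an optimized parameter (`cap_sum_ge_le`)
bounds the capacity of a deviation by a truncated second moment. These bounds are summable in `k`
because the Choquet integral of `|X 0|` is finite, and the Borel–Cantelli lemma applies; countable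
subadditivity is a consequence of continuity from below.

*Lower half* (`tendsto_cap_partialSum_gt`): `V(S_n / n > E[X 0] - ε) → 1`. For a bounded function
`g` and `m = E[g (X 0)]`, the exponential moments of the centred mean of the `g (X i)` converge to
`1` at every parameter `l ≥ 0` (`tendsto_ev_exp`). Comparing the parameters `l` and `l + l ^ 3`
shows that, for large `l`, the moment at `l` cannot come from the part where the centred mean is
below `-ε` or above `l⁻²`; this forces the capacity of `{mean > m - ε}` up to `1`. Continuity from
above then takes the place of the second Borel–Cantelli lemma: events whose capacities tend to `1`
occur infinitely often with capacity `1` (`cap_frequently_eq_one`).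

Both halves together give the laws for `liminf` and `limsup` separately. Along a rapidly growing
sequence `n_k` with independent blocks, the product formula shows that `S_{n_k} / n_k` is nearly
minimal and `S_{n_{k+1}} / n_{k+1}` nearly maximal on events whose capacities tend to `1`
(`tendsto_cap_blocks`), so both extremes are attained simultaneously. Finally `X n / n → 0`
outside a set of capacity zero, so the increments of `S_n / n` vanish and its cluster set fills the
whole interval (`clusterSet_eq_Icc`).
-/

/-! ### Bounded Lipschitz test functions -/

/-- Bounded globally Lipschitz functions. On this part of `C_{l,Lip}(ℝ)` every expectation is
finite, so the provisos in `IdentDist` and `ExtIndepFamily` hold. -/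
def BddLip (φ : ℝ → ℝ) : Prop :=
  (∃ K, LipschitzWith K φ) ∧ ∃ M : ℝ, ∀ x, |φ x| ≤ M

theorem LipschitzWith.locLip {φ : ℝ → ℝ} {K : NNReal} (h : LipschitzWith K φ) : LocLip φ := by
  refine ⟨K + 1, by positivity, 0, fun x y => ?_⟩
  have h1 := h.dist_le_mul x y
  rw [Real.dist_eq, dist_eq_norm] at h1
  have h2 : 0 ≤ ‖x - y‖ := norm_nonneg _
  have h3 : (0 : ℝ) ≤ K := K.2
  simp only [pow_zero]
  nlinarith [mul_nonneg h3 h2]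

theorem BddLip.locLip {φ : ℝ → ℝ} (h : BddLip φ) : LocLip φ := by
  obtain ⟨⟨K, hK⟩, -⟩ := h
  exact hK.locLip

theorem LocLip.comp_eval {n : ℕ} {φ : ℝ → ℝ} (h : LocLip φ) (i : Fin n) :
    LocLip (fun v : Fin n → ℝ => φ (v i)) := by
  obtain ⟨C, hC, m, h⟩ := h
  refine ⟨C, hC, m, fun x y => (h (x i) (y i)).trans ?_⟩
  have h1 : ‖x i‖ ≤ ‖x‖ := norm_le_pi_norm x i
  have h2 : ‖y i‖ ≤ ‖y‖ := norm_le_pi_norm y i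
  have h3 : ‖x i - y i‖ ≤ ‖x - y‖ := norm_le_pi_norm (x - y) i
  gcongr

theorem BddLip.comp_lipschitz {φ h : ℝ → ℝ} (hφ : BddLip φ) {K : NNReal}
    (hh : LipschitzWith K h) : BddLip (fun x => φ (h x)) := by
  obtain ⟨⟨K', hK'⟩, M, hM⟩ := hφ
  exact ⟨⟨_, hK'.comp hh⟩, M, fun x => hM _⟩

theorem BddLip.contDiff_comp {φ g : ℝ → ℝ} (hg : ContDiff ℝ 1 g) (hφ : BddLip φ) :
    BddLip (fun x => g (φ x)) := by
  obtain ⟨⟨K, hK⟩, M, hM⟩ := hφ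
  have hmem : ∀ x, φ x ∈ Set.Icc (-M) M := fun x => abs_le.1 (hM x)
  obtain ⟨K', hK'⟩ := LocallyLipschitzOn.exists_lipschitzOnWith_of_compact
    (isCompact_Icc (a := -M) (b := M))
    (hg.locallyLipschitz.locallyLipschitzOn (s := Set.Icc (-M) M))
  obtain ⟨M', hM'⟩ := (isCompact_Icc (a := -M) (b := M)).exists_bound_of_continuousOn
    hg.continuous.continuousOn
  refine ⟨⟨K' * K, LipschitzWith.of_dist_le_mul fun x y => ?_⟩, M', fun x => hM' _ (hmem x)⟩
  refine (hK'.dist_le_mul _ (hmem x) _ (hmem y)).trans ?_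
  rw [NNReal.coe_mul, mul_assoc]
  exact mul_le_mul_of_nonneg_left (hK.dist_le_mul x y) K'.2

theorem LipschitzWith.bddLip_clamp {h : ℝ → ℝ} {K : NNReal} (hh : LipschitzWith K h) (a b : ℝ) :
    BddLip (fun x => max a (min b (h x))) := by
  refine ⟨⟨K, (hh.const_min b).const_max a⟩, max |a| |b|, fun x => ?_⟩
  change |max a (min b (h x))| ≤ max |a| |b|
  rcases max_cases a (min b (h x)) with ⟨h1, h2⟩ | ⟨h1, h2⟩
  · rw [h1]; exact le_max_left _ _
  · rw [h1]
    have h3 := min_le_left b (h x)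
    have h4 := le_max_left |a| |b|
    have h5 := le_max_right |a| |b|
    have h6 := neg_abs_le a
    have h7 := le_abs_self b
    exact abs_le.2 ⟨by linarith, by linarith⟩

theorem lipschitzWith_affine (a b : ℝ) : LipschitzWith ‖a‖₊ (fun x : ℝ => a * x + b) :=
  LipschitzWith.of_dist_le_mul fun x y => by
    rw [Real.dist_eq, Real.dist_eq, coe_nnnorm, Real.norm_eq_abs, ← abs_mul]
    exact le_of_eq (by ring_nf)

/-- The Lipschitz function that is `0` on `(-∞, 0]`, `1` on `[1, ∞)` and linear in between. -/
noncomputable def ramp (x : ℝ) : ℝ := max 0 (min 1 x)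

theorem ramp_nonneg (x : ℝ) : 0 ≤ ramp x := le_max_left _ _

theorem ramp_le_one (x : ℝ) : ramp x ≤ 1 := max_le zero_le_one (min_le_left _ _)

theorem ramp_of_one_le {x : ℝ} (h : 1 ≤ x) : ramp x = 1 := by
  rw [ramp, min_eq_left h, max_eq_right zero_le_one]

theorem ramp_of_nonpos {x : ℝ} (h : x ≤ 0) : ramp x = 0 := by
  rw [ramp, min_eq_right (h.trans zero_le_one), max_eq_left h]

theorem LipschitzWith.bddLip_ramp {h : ℝ → ℝ} {K : NNReal} (hh : LipschitzWith K h) (a b : ℝ) :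
    BddLip (fun x => ramp (a * h x + b)) :=
  ((lipschitzWith_affine a b).comp hh).bddLip_clamp 0 1

namespace SubLinearExpectation

variable {Ω : Type*} [MeasurableSpace Ω] (S : SubLinearExpectation Ω)

/-! ### The space of random variables -/

theorem const_mem (c : ℝ) : (fun _ => c) ∈ S.H :=
  S.comp_mem 0 Fin.elim0 (fun _ => c) (fun i => i.elim0) ⟨1, one_pos, 0, fun x y => by
    simp only [sub_self, abs_zero]; positivity⟩

variable {S}

theorem comp_mem_one {X : Ω → ℝ} (hX : X ∈ S.H) {φ : ℝ → ℝ} (hφ : LocLip φ) :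
    (fun ω => φ (X ω)) ∈ S.H :=
  S.comp_mem 1 (fun _ => X) (fun v => φ (v 0)) (fun _ => hX) (hφ.comp_eval 0)

theorem mul_mem {X Y : Ω → ℝ} (hX : X ∈ S.H) (hY : Y ∈ S.H) : (fun ω => X ω * Y ω) ∈ S.H := by
  refine S.comp_mem 2 ![X, Y] (fun v => v 0 * v 1) (fun i => ?_) ⟨1, one_pos, 1, fun x y => ?_⟩
  · fin_cases i <;> assumption
  · have h1 := norm_le_pi_norm x 0
    have h2 := norm_le_pi_norm y 1
    have h3 : ‖x 0 - y 0‖ ≤ ‖x - y‖ := norm_le_pi_norm (x - y) 0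
    have h4 : ‖x 1 - y 1‖ ≤ ‖x - y‖ := norm_le_pi_norm (x - y) 1
    have h5 : x 0 * x 1 - y 0 * y 1 = x 0 * (x 1 - y 1) + y 1 * (x 0 - y 0) := by ring
    calc |x 0 * x 1 - y 0 * y 1| ≤ |x 0| * |x 1 - y 1| + |y 1| * |x 0 - y 0| := by
          rw [h5, ← abs_mul, ← abs_mul]; exact abs_add_le _ _
      _ ≤ ‖x‖ * ‖x - y‖ + ‖y‖ * ‖x - y‖ := by
          simp only [Real.norm_eq_abs] at h1 h2 h3 h4
          gcongr
      _ ≤ 1 * (1 + ‖x‖ ^ 1 + ‖y‖ ^ 1) * ‖x - y‖ := by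
          have := norm_nonneg (x - y)
          nlinarith

theorem prod_mem {ι : Type*} (s : Finset ι) {Y : ι → Ω → ℝ} (hY : ∀ i, Y i ∈ S.H) :
    (fun ω => ∏ i ∈ s, Y i ω) ∈ S.H := by
  classical
  induction s using Finset.induction_on with
  | empty => simpa using S.const_mem 1
  | insert i s hi ih =>
    simp only [Finset.prod_insert hi]
    exact mul_mem (hY i) ih

theorem sum_mem' {ι : Type*} (s : Finset ι) {Y : ι → Ω → ℝ} (hY : ∀ i, Y i ∈ S.H) :
    (fun ω => ∑ i ∈ s, Y i ω) ∈ S.H := by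
  convert S.H.sum_mem (t := s) (fun i _ => hY i) using 1
  ext ω
  simp

theorem add_mem' {X Y : Ω → ℝ} (hX : X ∈ S.H) (hY : Y ∈ S.H) : (fun ω => X ω + Y ω) ∈ S.H :=
  S.H.add_mem hX hY

theorem neg_mem' {X : Ω → ℝ} (hX : X ∈ S.H) : (fun ω => - X ω) ∈ S.H :=
  S.H.neg_mem hX

theorem const_mul_mem {X : Ω → ℝ} (hX : X ∈ S.H) (c : ℝ) : (fun ω => c * X ω) ∈ S.H :=
  S.H.smul_mem c hX

theorem abs_mem {X : Ω → ℝ} (hX : X ∈ S.H) : (fun ω => |X ω|) ∈ S.H :=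
  comp_mem_one hX (lipschitzWith_one_norm (E := ℝ)).locLip

theorem partialSum_mem {X : ℕ → Ω → ℝ} (hX : ∀ i, X i ∈ S.H) (n : ℕ) : partialSum X n ∈ S.H :=
  sum_mem' _ hX

variable (S)

/-! ### Random variables with finite absolute mean -/

/-- `X` belongs to `H` and `|X|` has finite upper expectation. -/
def FiniteMean (X : Ω → ℝ) : Prop := X ∈ S.H ∧ S.E (fun ω => |X ω|) ≠ ⊤

/-- The real value of the sub-linear expectation, meaningful on `FiniteMean` variables. -/
noncomputable def ev (X : Ω → ℝ) : ℝ := (S.E X).toReal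

variable {S}

theorem E_nonneg {X : Ω → ℝ} (hX : X ∈ S.H) (h : ∀ ω, 0 ≤ X ω) : 0 ≤ S.E X := by
  have := S.mono X hX _ (S.const_mem 0) h
  rwa [S.const, EReal.coe_zero] at this

namespace FiniteMean

variable {X Y : Ω → ℝ}

theorem of_le (hX : X ∈ S.H) (hY : FiniteMean S Y) (h : ∀ ω, |X ω| ≤ Y ω) : FiniteMean S X := by
  refine ⟨hX, ne_top_of_le_ne_top hY.2 (S.mono _ (abs_mem hY.1) _ (abs_mem hX) fun ω => ?_)⟩
  exact (h ω).trans (le_abs_self _)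

theorem const (c : ℝ) : FiniteMean S (fun _ => c) :=
  ⟨S.const_mem c, by rw [S.const]; exact EReal.coe_ne_top _⟩

theorem of_bdd (hX : X ∈ S.H) {M : ℝ} (h : ∀ ω, |X ω| ≤ M) : FiniteMean S X :=
  of_le hX (const M) h

theorem neg (hX : FiniteMean S X) : FiniteMean S (fun ω => - X ω) :=
  ⟨neg_mem' hX.1, by simpa only [abs_neg] using hX.2⟩

theorem abs (hX : FiniteMean S X) : FiniteMean S (fun ω => |X ω|) :=
  ⟨abs_mem hX.1, by simpa only [abs_abs] using hX.2⟩

theorem E_ne_top (hX : FiniteMean S X) : S.E X ≠ ⊤ :=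
  ne_top_of_le_ne_top hX.2 (S.mono _ (abs_mem hX.1) _ hX.1 fun _ => le_abs_self _)

/-- `0 = E[X - X] ≤ E[X] + E[-X]` with `E[-X] < ⊤` excludes `E[X] = ⊥`. -/
theorem E_ne_bot (hX : FiniteMean S X) : S.E X ≠ ⊥ := by
  intro h
  have h1 := S.subadd X hX.1 _ hX.neg.1 (by simp [h]) (fun h' => hX.neg.E_ne_top h'.2)
  rw [h, EReal.bot_add] at h1
  simp only [add_neg_cancel] at h1
  rw [S.const] at h1
  exact absurd h1 (by simp)

theorem coe_ev (hX : FiniteMean S X) : (S.ev X : EReal) = S.E X :=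
  EReal.coe_toReal hX.E_ne_top hX.E_ne_bot

theorem add (hX : FiniteMean S X) (hY : FiniteMean S Y) : FiniteMean S (fun ω => X ω + Y ω) := by
  refine ⟨add_mem' hX.1 hY.1, ?_⟩
  have h1 := S.subadd _ hX.abs.1 _ hY.abs.1 (fun h => hX.2 h.1) (fun h => hY.2 h.2)
  have h2 := S.mono _ (add_mem' hX.abs.1 hY.abs.1) _ (abs_mem (add_mem' hX.1 hY.1))
    fun _ => abs_add_le _ _
  refine ne_top_of_le_ne_top ?_ (h2.trans h1)
  rw [← hX.abs.coe_ev, ← hY.abs.coe_ev, ← EReal.coe_add]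
  exact EReal.coe_ne_top _

theorem const_mul (hX : FiniteMean S X) (c : ℝ) : FiniteMean S (fun ω => c * X ω) := by
  refine ⟨const_mul_mem hX.1 c, ?_⟩
  have h := S.pos_homog _ hX.abs.1 |c| (abs_nonneg c)
  simp only [abs_mul]
  rw [h, ← hX.abs.coe_ev, ← EReal.coe_mul]
  exact EReal.coe_ne_top _

end FiniteMean

theorem ev_const (c : ℝ) : S.ev (fun _ => c) = c := by rw [ev, S.const, EReal.toReal_coe]

theorem ev_mono {X Y : Ω → ℝ} (hX : FiniteMean S X) (hY : FiniteMean S Y) (h : ∀ ω, X ω ≤ Y ω) :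
    S.ev X ≤ S.ev Y := by
  rw [← EReal.coe_le_coe_iff, hX.coe_ev, hY.coe_ev]
  exact S.mono _ hY.1 _ hX.1 h

theorem ev_add_le {X Y : Ω → ℝ} (hX : FiniteMean S X) (hY : FiniteMean S Y) :
    S.ev (fun ω => X ω + Y ω) ≤ S.ev X + S.ev Y := by
  rw [← EReal.coe_le_coe_iff, (hX.add hY).coe_ev, EReal.coe_add, hX.coe_ev, hY.coe_ev]
  exact S.subadd _ hX.1 _ hY.1 (fun h => hX.E_ne_top h.1) (fun h => hY.E_ne_top h.2)

theorem ev_const_mul {X : Ω → ℝ} (hX : FiniteMean S X) {c : ℝ} (hc : 0 ≤ c) :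
    S.ev (fun ω => c * X ω) = c * S.ev X := by
  rw [← EReal.coe_eq_coe_iff, (hX.const_mul c).coe_ev, EReal.coe_mul, hX.coe_ev]
  exact S.pos_homog _ hX.1 c hc

theorem ev_add_const {X : Ω → ℝ} (hX : FiniteMean S X) (c : ℝ) :
    S.ev (fun ω => X ω + c) = S.ev X + c := by
  apply le_antisymm
  · simpa only [ev_const] using ev_add_le hX (FiniteMean.const c)
  · have := ev_add_le (hX.add (FiniteMean.const c)) (FiniteMean.const (-c))
    simp only [ev_const, add_neg_cancel_right] at this
    linarith

theorem ev_nonneg {X : Ω → ℝ} (hX : FiniteMean S X) (h : ∀ ω, 0 ≤ X ω) : 0 ≤ S.ev X := by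
  simpa only [ev_const] using ev_mono (FiniteMean.const 0) hX h

theorem _root_.BddLip.finiteMean {φ : ℝ → ℝ} (hφ : BddLip φ) {X : Ω → ℝ} (hX : X ∈ S.H) :
    FiniteMean S (fun ω => φ (X ω)) := by
  obtain ⟨M, hM⟩ := hφ.2
  exact FiniteMean.of_bdd (comp_mem_one hX hφ.locLip) fun ω => hM _

theorem finiteMean_of_mem_unitInterval {X : Ω → ℝ} (hX : X ∈ S.H) (h0 : ∀ ω, 0 ≤ X ω)
    (h1 : ∀ ω, X ω ≤ 1) : FiniteMean S X :=
  FiniteMean.of_bdd hX fun ω => abs_le.2 ⟨by linarith [h0 ω], h1 ω⟩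

/-! ### The capacity -/

variable (S)

/-- The capacity as a real number. -/
noncomputable def cap (A : Set Ω) : ℝ := (S.capacity A).toReal

theorem capacity_nonneg (A : Set Ω) : 0 ≤ S.capacity A := by
  refine le_sInf ?_
  rintro e ⟨ξ, hξ, h, rfl⟩
  exact E_nonneg hξ fun ω => (Set.indicator_nonneg (fun _ _ => zero_le_one) ω).trans (h ω)

theorem capacity_le_one (A : Set Ω) : S.capacity A ≤ 1 := by
  refine sInf_le ⟨fun _ => 1, S.const_mem 1, fun ω => ?_, ?_⟩
  · exact Set.indicator_le' (fun _ _ => le_rfl) (fun _ _ => zero_le_one) ω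
  · rw [S.const, EReal.coe_one]

/-- The capacity lies in `[0, 1]`, so nothing is lost in passing to its real value. -/
theorem coe_cap (A : Set Ω) : (S.cap A : EReal) = S.capacity A := by
  refine EReal.coe_toReal (fun h => ?_) (fun h => ?_)
  · have := S.capacity_le_one A
    rw [h] at this
    exact absurd this (by decide)
  · have := S.capacity_nonneg A
    rw [h] at this
    exact absurd this (by decide)

theorem cap_nonneg (A : Set Ω) : 0 ≤ S.cap A := EReal.toReal_nonneg (S.capacity_nonneg A)

theorem cap_le_one (A : Set Ω) : S.cap A ≤ 1 := by
  rw [← EReal.coe_le_coe_iff, S.coe_cap]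
  exact S.capacity_le_one A

variable {S}

theorem cap_mono {A B : Set Ω} (h : A ⊆ B) : S.cap A ≤ S.cap B := by
  rw [← EReal.coe_le_coe_iff, S.coe_cap, S.coe_cap]
  refine le_sInf ?_
  rintro e ⟨ξ, hξ, h', rfl⟩
  exact sInf_le ⟨ξ, hξ, fun ω =>
    (Set.indicator_le_indicator_of_subset h (fun _ => zero_le_one) ω).trans (h' ω), rfl⟩

theorem cap_le_ev {A : Set Ω} {ξ : Ω → ℝ} (hξ : FiniteMean S ξ) (h0 : ∀ ω, 0 ≤ ξ ω)
    (h : ∀ ω ∈ A, 1 ≤ ξ ω) : S.cap A ≤ S.ev ξ := by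
  rw [← EReal.coe_le_coe_iff, S.coe_cap, hξ.coe_ev]
  exact sInf_le ⟨ξ, hξ.1, Set.indicator_le' h fun ω _ => h0 ω, rfl⟩

theorem ev_le_cap {A : Set Ω} {ξ : Ω → ℝ} (hξ : FiniteMean S ξ) (h1 : ∀ ω, ξ ω ≤ 1)
    (h : ∀ ω ∉ A, ξ ω ≤ 0) : S.ev ξ ≤ S.cap A := by
  rw [← EReal.coe_le_coe_iff, S.coe_cap, hξ.coe_ev]
  refine le_sInf ?_
  rintro e ⟨η, hη, h', rfl⟩
  refine S.mono _ hη _ hξ.1 fun ω => le_trans ?_ (h' ω)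
  by_cases hω : ω ∈ A
  · rw [Set.indicator_of_mem hω]; exact h1 ω
  · rw [Set.indicator_of_notMem hω]; exact h ω hω

/-- Almost optimal majorants of an indicator, cut off at `1`. -/
theorem exists_ev_lt_cap_add (A : Set Ω) {ε : ℝ} (hε : 0 < ε) :
    ∃ ξ, FiniteMean S ξ ∧ (∀ ω, 0 ≤ ξ ω) ∧ (∀ ω ∈ A, 1 ≤ ξ ω) ∧ S.ev ξ < S.cap A + ε := by
  have h1 : S.capacity A < ((S.cap A + ε : ℝ) : EReal) := by
    rw [← S.coe_cap, EReal.coe_lt_coe_iff]; linarith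
  obtain ⟨e, ⟨ξ, hξ, h, rfl⟩, hlt⟩ := sInf_lt_iff.1 h1
  have h0 : ∀ ω, 0 ≤ ξ ω := fun ω => (Set.indicator_nonneg (fun _ _ => zero_le_one) ω).trans (h ω)
  have hm : (fun ω => min (ξ ω) 1) ∈ S.H :=
    comp_mem_one hξ (LipschitzWith.id.min_const (1 : ℝ)).locLip
  have hf : FiniteMean S (fun ω => min (ξ ω) 1) := finiteMean_of_mem_unitInterval hm
    (fun ω => le_min (h0 ω) zero_le_one) (fun ω => min_le_right _ _)
  refine ⟨_, hf, fun ω => le_min (h0 ω) zero_le_one, fun ω hω => le_min ?_ le_rfl, ?_⟩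
  · simpa [hω] using h ω
  · rw [← EReal.coe_lt_coe_iff, hf.coe_ev]
    exact (S.mono _ hξ _ hm fun ω => min_le_left _ _).trans_lt hlt

theorem cap_union_le (A B : Set Ω) : S.cap (A ∪ B) ≤ S.cap A + S.cap B := by
  refine le_of_forall_pos_le_add fun ε hε => ?_
  obtain ⟨ξ, hξ, h0, h1, h2⟩ := exists_ev_lt_cap_add (S := S) A (half_pos hε)
  obtain ⟨η, hη, h0', h1', h2'⟩ := exists_ev_lt_cap_add (S := S) B (half_pos hε)
  have := cap_le_ev (A := A ∪ B) (hξ.add hη) (fun ω => add_nonneg (h0 ω) (h0' ω)) (by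
    rintro ω (hω | hω)
    · linarith [h1 ω hω, h0' ω]
    · linarith [h1' ω hω, h0 ω])
  linarith [ev_add_le hξ hη]

theorem cap_univ : S.cap Set.univ = 1 := by
  refine le_antisymm (S.cap_le_one _) ?_
  have := ev_le_cap (S := S) (A := Set.univ) (FiniteMean.const 1) (fun _ => le_rfl) (by simp)
  rwa [ev_const] at this

theorem cap_empty : S.cap ∅ = 0 := by
  refine le_antisymm ?_ (S.cap_nonneg _)
  have := cap_le_ev (S := S) (A := ∅) (FiniteMean.const 0) (fun _ => le_rfl) (by simp)
  rwa [ev_const] at this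

theorem cap_biUnion_le {ι : Type*} (s : Finset ι) (A : ι → Set Ω) :
    S.cap (⋃ i ∈ s, A i) ≤ ∑ i ∈ s, S.cap (A i) := by
  classical
  induction s using Finset.induction_on with
  | empty => simp [cap_empty]
  | insert i s hi ih =>
    rw [Finset.set_biUnion_insert, Finset.sum_insert hi]
    exact (cap_union_le _ _).trans (by linarith)

/-! ### Consequences of the continuity of the capacity -/

theorem measurableSet_eventually {p : ℕ → Ω → Prop} (h : ∀ n, MeasurableSet {ω | p n ω}) :
    MeasurableSet {ω | ∀ᶠ n in atTop, p n ω} := by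
  have : {ω | ∀ᶠ n in atTop, p n ω} = ⋃ N : ℕ, ⋂ n : ℕ, ⋂ _ : N ≤ n, {ω | p n ω} := by
    ext ω; simp [eventually_atTop]
  rw [this]
  exact .iUnion fun N => .iInter fun n => .iInter fun _ => h n

theorem measurableSet_frequently {p : ℕ → Ω → Prop} (h : ∀ n, MeasurableSet {ω | p n ω}) :
    MeasurableSet {ω | ∃ᶠ n in atTop, p n ω} :=
  (measurableSet_eventually (p := fun n ω => ¬ p n ω) fun n => (h n).compl).compl

namespace CapacityContinuous

variable (hc : S.CapacityContinuous)

include hc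

theorem tendsto_cap_iUnion {A : ℕ → Set Ω} (hA : ∀ n, MeasurableSet (A n)) (hm : Monotone A) :
    Tendsto (fun n => S.cap (A n)) atTop (𝓝 (S.cap (⋃ n, A n))) := by
  have := hc.1 A hA hm
  simp only [← S.coe_cap] at this
  exact EReal.tendsto_coe.1 this

theorem tendsto_cap_iInter {A : ℕ → Set Ω} (hA : ∀ n, MeasurableSet (A n)) (hm : Antitone A) :
    Tendsto (fun n => S.cap (A n)) atTop (𝓝 (S.cap (⋂ n, A n))) := by
  have := hc.2 A hA hm
  simp only [← S.coe_cap] at this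
  exact EReal.tendsto_coe.1 this

theorem cap_iUnion_le_of_sum_le {A : ℕ → Set Ω} (hA : ∀ n, MeasurableSet (A n)) {c : ℝ}
    (h : ∀ n, ∑ i ∈ Finset.range n, S.cap (A i) ≤ c) : S.cap (⋃ n, A n) ≤ c := by
  have h1 : (⋃ n, A n) = ⋃ n : ℕ, ⋃ i ∈ Finset.range n, A i := by
    ext ω
    simp only [Set.mem_iUnion, Finset.mem_range, exists_prop]
    exact ⟨fun ⟨i, hi⟩ => ⟨i + 1, i, Nat.lt_succ_self i, hi⟩, fun ⟨_, i, _, hi⟩ => ⟨i, hi⟩⟩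
  rw [h1]
  refine le_of_tendsto' (hc.tendsto_cap_iUnion (fun n => ?_) fun m n hmn => ?_) fun n =>
    (cap_biUnion_le _ _).trans (h n)
  · exact Finset.measurableSet_biUnion _ fun i _ => hA i
  · exact Set.biUnion_subset_biUnion_left fun i hi =>
      Finset.mem_range.2 ((Finset.mem_range.1 hi).trans_le hmn)

theorem cap_iUnion_eq_zero {A : ℕ → Set Ω} (hA : ∀ n, MeasurableSet (A n))
    (h : ∀ n, S.cap (A n) = 0) : S.cap (⋃ n, A n) = 0 :=
  le_antisymm (hc.cap_iUnion_le_of_sum_le hA fun n => by simp [h]) (S.cap_nonneg _)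

/-- The first Borel–Cantelli lemma for a continuous capacity. -/
theorem cap_frequently_eq_zero {p : ℕ → Ω → Prop} (hp : ∀ n, MeasurableSet {ω | p n ω})
    (h : Summable fun n => S.cap {ω | p n ω}) : S.cap {ω | ∃ᶠ n in atTop, p n ω} = 0 := by
  refine le_antisymm (ge_of_tendsto' (tendsto_sum_nat_add fun n => S.cap {ω | p n ω}) fun N => ?_)
    (S.cap_nonneg _)
  have hsub : {ω | ∃ᶠ n in atTop, p n ω} ⊆ ⋃ n, {ω | p (n + N) ω} := by
    intro ω hω
    obtain ⟨n, hn, hpn⟩ := frequently_atTop.1 hω N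
    exact Set.mem_iUnion.2 ⟨n - N, by simpa [Nat.sub_add_cancel hn] using hpn⟩
  refine (cap_mono hsub).trans (hc.cap_iUnion_le_of_sum_le (fun n => hp _) fun n => ?_)
  exact ((summable_nat_add_iff N).2 h).sum_le_tsum _ fun i _ => S.cap_nonneg _

/-- Continuity from above replaces the second Borel–Cantelli lemma: if the capacities of the
events tend to `1`, then infinitely many of them occur with full capacity. -/
theorem cap_frequently_eq_one {p : ℕ → Ω → Prop} (hp : ∀ n, MeasurableSet {ω | p n ω})
    (h : Tendsto (fun n => S.cap {ω | p n ω}) atTop (𝓝 1)) :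
    S.cap {ω | ∃ᶠ n in atTop, p n ω} = 1 := by
  refine le_antisymm (S.cap_le_one _) ?_
  have h1 : {ω | ∃ᶠ n in atTop, p n ω} = ⋂ N : ℕ, ⋃ n : ℕ, ⋃ _ : N ≤ n, {ω | p n ω} := by
    ext ω; simp [frequently_atTop]
  rw [h1]
  refine le_of_tendsto_of_tendsto' h (hc.tendsto_cap_iInter (fun N => ?_) fun m n hmn => ?_)
    fun N => cap_mono ?_
  · exact .iUnion fun n => .iUnion fun _ => hp n
  · exact Set.iUnion_mono fun k => Set.iUnion_mono' fun hk => ⟨hmn.trans hk, le_rfl⟩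
  · exact Set.subset_iUnion₂ (s := fun n (_ : N ≤ n) => {ω | p n ω}) N le_rfl

theorem cap_iInter_eq_one {A : ℕ → Set Ω} (hA : ∀ n, MeasurableSet (A n)) (hm : Antitone A)
    (h : ∀ n, S.cap (A n) = 1) : S.cap (⋂ n, A n) = 1 := by
  have := hc.tendsto_cap_iInter hA hm
  simp only [h] at this
  exact (tendsto_nhds_unique this tendsto_const_nhds)

/-- If almost every path eventually satisfies `p n`, then `p n` fails with vanishing capacity. -/
theorem tendsto_cap_not {p : ℕ → Ω → Prop} (hp : ∀ n, MeasurableSet {ω | p n ω})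
    (h : S.cap {ω | ¬ ∀ᶠ n in atTop, p n ω} = 0) :
    Tendsto (fun n => S.cap {ω | ¬ p n ω}) atTop (𝓝 0) := by
  have h1 : {ω | ¬ ∀ᶠ n in atTop, p n ω} = ⋂ N : ℕ, ⋃ n : ℕ, ⋃ _ : N ≤ n, {ω | ¬ p n ω} := by
    ext ω; simp [eventually_atTop]
  rw [h1] at h
  have h2 := hc.tendsto_cap_iInter (A := fun N => ⋃ n : ℕ, ⋃ _ : N ≤ n, {ω | ¬ p n ω})
    (fun N => .iUnion fun n => .iUnion fun _ => (hp n).compl)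
    fun m n hmn => Set.iUnion_mono fun k => Set.iUnion_mono' fun hk => ⟨hmn.trans hk, le_rfl⟩
  rw [h] at h2
  refine squeeze_zero (fun n => S.cap_nonneg _) (fun n => cap_mono ?_) h2
  exact Set.subset_iUnion₂ (s := fun k (_ : n ≤ k) => {ω | ¬ p k ω}) n le_rfl

end CapacityContinuous

theorem cap_eq_one_of_subset_union {A B N : Set Ω} (hA : S.cap A = 1) (hN : S.cap N = 0)
    (h : A ⊆ B ∪ N) : S.cap B = 1 := by
  have h1 := cap_mono (S := S) h
  have h2 := cap_union_le (S := S) B N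
  exact le_antisymm (S.cap_le_one _) (by linarith)

theorem cap_union_eq_zero {A B : Set Ω} (hA : S.cap A = 0) (hB : S.cap B = 0) :
    S.cap (A ∪ B) = 0 :=
  le_antisymm ((cap_union_le A B).trans (by rw [hA, hB, add_zero])) (S.cap_nonneg _)

theorem cap_eq_zero_of_subset {A B : Set Ω} (hB : S.cap B = 0) (h : A ⊆ B) : S.cap A = 0 :=
  le_antisymm ((cap_mono h).trans hB.le) (S.cap_nonneg _)

/-- If `A n ⊆ B n ∪ N n` with `cap (A n) → 1` and `cap (N n) → 0`, then `cap (B n) → 1`. -/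
theorem tendsto_cap_one_of_subset_union {A B N : ℕ → Set Ω}
    (hA : Tendsto (fun n => S.cap (A n)) atTop (𝓝 1))
    (hN : Tendsto (fun n => S.cap (N n)) atTop (𝓝 0))
    (h : ∀ᶠ n in atTop, A n ⊆ B n ∪ N n) : Tendsto (fun n => S.cap (B n)) atTop (𝓝 1) := by
  have h1 := hA.sub hN
  rw [sub_zero] at h1
  refine tendsto_of_tendsto_of_tendsto_of_le_of_le' h1 tendsto_const_nhds ?_
    (Eventually.of_forall fun n => S.cap_le_one _)
  filter_upwards [h] with n hn
  linarith [cap_mono (S := S) hn, cap_union_le (S := S) (B n) (N n)]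

/-! ### The standing assumptions in terms of bounded test functions -/

theorem lintegral_capacity_ne_top {X : Ω → ℝ} (h : S.choquet (fun ω => |X ω|) < ⊤) :
    ∫⁻ t in Set.Ioi (0 : ℝ), ENNReal.ofReal (S.cap {ω | t ≤ |X ω|}) ≠ ⊤ := by
  have h1 : ∫⁻ t in Set.Iio (0 : ℝ), (1 - S.capacity {ω | t ≤ |X ω|}).toENNReal = 0 := by
    rw [setLIntegral_congr_fun (g := fun _ => 0) measurableSet_Iio, lintegral_zero]
    intro t ht
    have : {ω | t ≤ |X ω|} = Set.univ :=
      Set.eq_univ_of_forall fun ω => le_trans (le_of_lt ht) (abs_nonneg (X ω))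
    simp only [this]
    rw [← S.coe_cap, cap_univ, EReal.coe_one]
    have h2 : (1 : EReal) - 1 = 0 := EReal.sub_self (by decide) (by decide)
    rw [h2, EReal.toENNReal_zero]
  rw [choquet, h1] at h
  simp only [← S.coe_cap, EReal.real_coe_toENNReal, EReal.coe_ennreal_zero, sub_zero] at h
  exact fun h2 => absurd h (by rw [h2]; simp)

/-- Finiteness of the Choquet integral makes the dyadic tail series converge. -/
theorem summable_two_pow_mul_cap {X : Ω → ℝ} (h : S.choquet (fun ω => |X ω|) < ⊤) {r : ℝ}
    (hr : 0 < r) : Summable fun k : ℕ => (2 : ℝ) ^ k * S.cap {ω | r * 2 ^ k ≤ |X ω|} := by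
  have h0 := lintegral_capacity_ne_top h
  set F : ℝ → ℝ≥0∞ := fun t => ENNReal.ofReal (S.cap {ω | t ≤ |X ω|}) with hF
  have hmono : Monotone fun k : ℕ => r * (2 : ℝ) ^ k := fun a b hab => by
    dsimp only
    gcongr
    norm_num
  have h1 : ∑' k : ℕ, ∫⁻ t in Set.Ioc (r * (2 : ℝ) ^ k) (r * 2 ^ (k + 1)), F t ≤
      ∫⁻ t in Set.Ioi (0 : ℝ), F t := by
    have hd : Pairwise (Function.onFun Disjoint fun k : ℕ =>
        Set.Ioc (r * (2 : ℝ) ^ k) (r * 2 ^ (k + 1))) := hmono.pairwise_disjoint_on_Ioc_succ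
    rw [← lintegral_iUnion (fun k => measurableSet_Ioc) hd]
    refine lintegral_mono_set (Set.iUnion_subset fun k t ht => ?_)
    exact lt_trans (by positivity) ht.1
  have h2 : ∀ k : ℕ, ENNReal.ofReal (r * 2 ^ k * S.cap {ω | r * 2 ^ (k + 1) ≤ |X ω|}) ≤
      ∫⁻ t in Set.Ioc (r * (2 : ℝ) ^ k) (r * 2 ^ (k + 1)), F t := by
    intro k
    have h3 : ∫⁻ _ in Set.Ioc (r * (2 : ℝ) ^ k) (r * 2 ^ (k + 1)), F (r * 2 ^ (k + 1)) ≤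
        ∫⁻ t in Set.Ioc (r * (2 : ℝ) ^ k) (r * 2 ^ (k + 1)), F t := by
      refine setLIntegral_mono' measurableSet_Ioc fun t ht => ENNReal.ofReal_le_ofReal ?_
      exact cap_mono fun ω hω => ht.2.trans hω
    rw [setLIntegral_const, Real.volume_Ioc, hF] at h3
    dsimp only at h3
    rw [← ENNReal.ofReal_mul (S.cap_nonneg _)] at h3
    convert h3 using 2
    ring
  have h4 : Summable fun k : ℕ => r * 2 ^ k * S.cap {ω | r * 2 ^ (k + 1) ≤ |X ω|} := by
    have h5 : ∑' k : ℕ, ENNReal.ofReal (r * 2 ^ k * S.cap {ω | r * 2 ^ (k + 1) ≤ |X ω|}) ≠ ⊤ :=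
      ne_top_of_le_ne_top h0 ((ENNReal.tsum_le_tsum h2).trans h1)
    refine (ENNReal.summable_toReal h5).congr fun k => ENNReal.toReal_ofReal ?_
    have := S.cap_nonneg {ω | r * 2 ^ (k + 1) ≤ |X ω|}
    positivity
  rw [← summable_nat_add_iff 1]
  refine (h4.mul_left (2 / r)).congr fun k => ?_
  field_simp
  ring

/-- The working form of the assumptions of the strong law. Independence, identity of the laws and
the moment conditions enter the argument only through bounded Lipschitz test functions and the
dyadic tails of `X 0`; in this form they are invariant under `X ↦ -X`. -/
structure StrongLawSetting (S : SubLinearExpectation Ω) (X : ℕ → Ω → ℝ) : Prop where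
  mem : ∀ i, X i ∈ S.H
  ident : ∀ φ, BddLip φ → ∀ i, S.ev (fun ω => φ (X i ω)) = S.ev (fun ω => φ (X 0 ω))
  prod : ∀ ψ, BddLip ψ → (∀ x, 0 ≤ ψ x) → ∀ n : ℕ,
    S.ev (fun ω => ∏ i ∈ Finset.range n, ψ (X i ω)) = S.ev (fun ω => ψ (X 0 ω)) ^ n
  tail : ∀ r : ℝ, 0 < r → Summable fun k : ℕ => (2 : ℝ) ^ k * S.cap {ω | r * 2 ^ k ≤ |X 0 ω|}
  unif : ∀ ε : ℝ, 0 < ε → ∃ c : ℝ, 0 ≤ c ∧ FiniteMean S (fun ω => max (|X 0 ω| - c) 0) ∧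
    S.ev (fun ω => max (|X 0 ω| - c) 0) ≤ ε
  cont : S.CapacityContinuous

theorem IdentDist.ev_eq {X Y : Ω → ℝ} (h : S.IdentDist X Y) (hX : X ∈ S.H) (hY : Y ∈ S.H)
    {φ : ℝ → ℝ} (hφ : BddLip φ) : S.ev (fun ω => φ (X ω)) = S.ev (fun ω => φ (Y ω)) := by
  have h1 := hφ.finiteMean hX
  have h2 := hφ.finiteMean hY
  rw [ev, ev, h φ hφ.locLip h1.E_ne_top h1.E_ne_bot h2.E_ne_top h2.E_ne_bot]

theorem finiteMean_prod {ι : Type*} (s : Finset ι) {Y : ι → Ω → ℝ} (hY : ∀ i, Y i ∈ S.H)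
    {M : ι → ℝ} (hM : ∀ i ω, |Y i ω| ≤ M i) : FiniteMean S (fun ω => ∏ i ∈ s, Y i ω) := by
  refine FiniteMean.of_bdd (M := ∏ i ∈ s, M i) (prod_mem s hY) fun ω => ?_
  rw [Finset.abs_prod]
  exact Finset.prod_le_prod (fun i _ => abs_nonneg _) fun i _ => hM i ω

theorem ereal_coe_prod {ι : Type*} (s : Finset ι) (f : ι → ℝ) :
    ((∏ i ∈ s, f i : ℝ) : EReal) = ∏ i ∈ s, (f i : EReal) :=
  map_prod (⟨⟨Real.toEReal, EReal.coe_one⟩, EReal.coe_mul⟩ : ℝ →* EReal) f s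

theorem ExtIndepFamily.ev_prod {n : ℕ} {Y : Fin n → Ω → ℝ} (h : S.ExtIndepFamily Y)
    (hY : ∀ i, Y i ∈ S.H) {ψ : Fin n → ℝ → ℝ} (hψ : ∀ i, BddLip (ψ i)) (h0 : ∀ i x, 0 ≤ ψ i x) :
    S.ev (fun ω => ∏ i, ψ i (Y i ω)) = ∏ i, S.ev (fun ω => ψ i (Y i ω)) := by
  have h1 : FiniteMean S (fun ω => ∏ i, ψ i (Y i ω)) := by
    choose M hM using fun i => (hψ i).2
    exact finiteMean_prod _ (fun i => comp_mem_one (hY i) (hψ i).locLip) fun i ω => hM i _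
  have h2 := fun i => (hψ i).finiteMean (hY i)
  rw [← EReal.coe_eq_coe_iff, h1.coe_ev, ereal_coe_prod]
  simp only [(h2 _).coe_ev]
  exact h ψ (fun i => (hψ i).locLip) h0 (fun i => (h2 i).E_ne_top) h1.E_ne_top

theorem ExtIndepPair.ev_mul {Y Z : Ω → ℝ} (h : S.ExtIndepPair Y Z) (hY : Y ∈ S.H) (hZ : Z ∈ S.H)
    {φ ψ : ℝ → ℝ} (hφ : BddLip φ) (hψ : BddLip ψ) (hφ0 : ∀ x, 0 ≤ φ x) (hψ0 : ∀ x, 0 ≤ ψ x) :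
    S.ev (fun ω => φ (Y ω) * ψ (Z ω)) = S.ev (fun ω => φ (Y ω)) * S.ev (fun ω => ψ (Z ω)) := by
  have h1 := ExtIndepFamily.ev_prod h (ψ := ![φ, ψ]) (fun i => by fin_cases i <;> assumption)
    (fun i => by fin_cases i <;> assumption) (fun i => by fin_cases i <;> assumption)
  simpa [Fin.prod_univ_two] using h1

theorem strongLawSetting {X : ℕ → Ω → ℝ} (hX : ∀ n, X n ∈ S.H) (hindep : S.ExtIndep X)
    (hident : ∀ n, S.IdentDist (X n) (X 0)) (hchoquet : S.choquet (fun ω => |X 0 ω|) < ⊤)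
    (hui : Tendsto (fun c : ℝ => S.E (fun ω => max (|X 0 ω| - c) 0)) atTop (𝓝 0))
    (hcont : S.CapacityContinuous) : StrongLawSetting S X where
  mem := hX
  ident φ hφ i := (hident i).ev_eq (hX i) (hX 0) hφ
  prod ψ hψ h0 n := by
    -- `ExtIndep` says nothing about fewer than two factors, where the formula is trivial
    rcases lt_or_ge n 2 with hn | hn
    · interval_cases n
      · simp [ev_const]
      · simp
    · simp only [Finset.prod_range]
      rw [(hindep n hn).ev_prod (fun i => hX i) (fun _ => hψ) (fun _ => h0)]
      simp only [(hident _).ev_eq (hX _) (hX 0) hψ, Finset.prod_const, Finset.card_univ,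
        Fintype.card_fin]
  tail r hr := summable_two_pow_mul_cap hchoquet hr
  unif ε hε := by
    have h1 : ∀ᶠ c : ℝ in atTop, S.E (fun ω => max (|X 0 ω| - c) 0) < ((ε : ℝ) : EReal) :=
      hui.eventually_lt_const (by exact_mod_cast hε)
    obtain ⟨c, hc, hc0⟩ := (h1.and (eventually_ge_atTop 0)).exists
    have hmem : (fun ω => max (|X 0 ω| - c) 0) ∈ S.H :=
      comp_mem_one (φ := fun x => max (|x| - c) 0) (hX 0)
        (((lipschitzWith_one_norm (E := ℝ)).sub (LipschitzWith.const c)).max_const 0).locLip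
    have hf : FiniteMean S (fun ω => max (|X 0 ω| - c) 0) := by
      refine ⟨hmem, ?_⟩
      simp only [abs_of_nonneg (le_max_right (|X 0 _| - c) 0)]
      exact (hc.trans (EReal.coe_lt_top _)).ne
    refine ⟨c, hc0, hf, ?_⟩
    rw [← EReal.coe_le_coe_iff, hf.coe_ev]
    exact hc.le
  cont := hcont

theorem _root_.BddLip.comp_neg {φ : ℝ → ℝ} (h : BddLip φ) : BddLip (fun x => φ (-x)) :=
  h.comp_lipschitz LipschitzWith.id.neg

namespace StrongLawSetting

variable {X : ℕ → Ω → ℝ} (h : StrongLawSetting S X)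

include h

theorem neg : StrongLawSetting S (fun i ω => - X i ω) where
  mem i := neg_mem' (h.mem i)
  ident φ hφ i := h.ident _ hφ.comp_neg i
  prod ψ hψ h0 n := h.prod _ hψ.comp_neg (fun x => h0 _) n
  tail r hr := by simpa only [abs_neg] using h.tail r hr
  unif ε hε := by simpa only [abs_neg] using h.unif ε hε
  cont := h.cont

theorem measurable (i : ℕ) : Measurable (X i) := S.measurable_of_mem _ (h.mem i)

theorem finiteMean_zero : FiniteMean S (X 0) := by
  obtain ⟨c, -, hf, -⟩ := h.unif 1 one_pos
  refine FiniteMean.of_le (h.mem 0) (hf.add (FiniteMean.const c)) fun ω => ?_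
  linarith [le_max_left (|X 0 ω| - c) 0]

end StrongLawSetting

/-! ### The upper half of the law for non-negative variables -/

/-- The remainder `exp a - 1 - a` decreases at least quadratically when `a ≥ 0` is scaled down. -/
theorem exp_mul_sub_le {t a : ℝ} (ht0 : 0 ≤ t) (ht1 : t ≤ 1) (ha : 0 ≤ a) :
    Real.exp (t * a) - 1 - t * a ≤ t ^ 2 * (Real.exp a - 1 - a) := by
  have key : ∀ x : ℝ, HasSum (fun n : ℕ => x ^ (n + 2) / (n + 2).factorial)
      (Real.exp x - 1 - x) := by
    intro x
    have h1 := NormedSpace.expSeries_div_hasSum_exp (𝔸 := ℝ) x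
    rw [← Real.exp_eq_exp_ℝ, ← hasSum_nat_add_iff' 2] at h1
    simpa [Finset.sum_range_succ, sub_sub] using h1
  refine hasSum_le (fun n => ?_) (key (t * a)) ((key a).mul_left (t ^ 2))
  rw [mul_pow, pow_add t, mul_comm (t ^ n), mul_assoc, mul_div_assoc]
  refine mul_le_mul_of_nonneg_left ?_ (by positivity)
  gcongr
  exact mul_le_of_le_one_left (by positivity) (pow_le_one₀ ht0 ht1)

/-- Along the sequences `m * 2 ^ k`, `m ≥ 1`, a linear upper bound for a monotone sequence
extends to all indices, at the price of an arbitrarily small increase of the slope. -/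
theorem eventually_le_of_dyadic {T : ℕ → ℝ} (hT : Monotone T) {a ε : ℝ} (hε : 0 < ε)
    (ha : 0 ≤ a)
    (h : ∀ m : ℕ, 1 ≤ m → ∀ᶠ k : ℕ in atTop, T (m * 2 ^ k) ≤ ((m * 2 ^ k : ℕ) : ℝ) * a) :
    ∀ᶠ n : ℕ in atTop, T n ≤ n * (a + ε) := by
  obtain ⟨M, hM⟩ := exists_nat_ge (max 1 (a / ε))
  have hM1 : 1 ≤ M := by exact_mod_cast (le_max_left _ _).trans hM
  have hMa : a ≤ M * ε := (div_le_iff₀ hε).1 ((le_max_right _ _).trans hM)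
  have h1 : ∀ᶠ k : ℕ in atTop, ∀ m ∈ Finset.Icc 1 (2 * M),
      T (m * 2 ^ k) ≤ ((m * 2 ^ k : ℕ) : ℝ) * a :=
    (Filter.eventually_all_finset _).2 fun m hm => h m (Finset.mem_Icc.1 hm).1
  obtain ⟨k₀, hk₀⟩ := eventually_atTop.1 h1
  filter_upwards [eventually_ge_atTop (M * 2 ^ k₀)] with n hn
  -- `k` is chosen such that `M * 2 ^ k ≤ n < M * 2 ^ (k + 1)`
  set k := Nat.log 2 (n / M) with hk
  have hMpos : 0 < M := hM1
  have hnM : 2 ^ k₀ ≤ n / M := (Nat.le_div_iff_mul_le hMpos).2 (by rwa [mul_comm])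
  have hne : n / M ≠ 0 := (lt_of_lt_of_le (by positivity) hnM).ne'
  have hk0 : k₀ ≤ k := Nat.le_log_of_pow_le (by norm_num) hnM
  have hlow : M * 2 ^ k ≤ n := by
    have := Nat.pow_log_le_self 2 hne
    rw [mul_comm]
    exact (Nat.le_div_iff_mul_le hMpos).1 this
  have hup : n < 2 * M * 2 ^ k := by
    have := Nat.lt_pow_succ_log_self (b := 2) (by norm_num) (n / M)
    have h2 := (Nat.div_lt_iff_lt_mul hMpos).1 this
    calc n < 2 ^ (Nat.log 2 (n / M)).succ * M := h2
      _ = 2 * M * 2 ^ k := by rw [← hk, Nat.succ_eq_add_one, pow_succ]; ring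
  set j := n / 2 ^ k with hj
  have h2k : 0 < 2 ^ k := by positivity
  have hj1 : j + 1 ≤ 2 * M := (Nat.div_lt_iff_lt_mul h2k).2 hup
  have hj2 : j * 2 ^ k ≤ n := Nat.div_mul_le_self n _
  have hj4 : (j + 1) * 2 ^ k = j * 2 ^ k + 2 ^ k := by ring
  have hj3 : n ≤ (j + 1) * 2 ^ k := by
    have h2 := Nat.div_add_mod n (2 ^ k)
    have h3 := Nat.mod_lt n h2k
    rw [hj4, mul_comm j]
    rw [← hj] at h2
    omega
  have h3 := hk₀ k hk0 (j + 1) (Finset.mem_Icc.2 ⟨Nat.succ_pos j, hj1⟩)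
  have h4 : (((j + 1) * 2 ^ k : ℕ) : ℝ) ≤ n + 2 ^ k := by
    have : (j + 1) * 2 ^ k ≤ n + 2 ^ k := hj4 ▸ Nat.add_le_add_right hj2 _
    exact_mod_cast this
  have h5 : (M : ℝ) * 2 ^ k ≤ n := by exact_mod_cast hlow
  calc T n ≤ T ((j + 1) * 2 ^ k) := hT hj3
    _ ≤ (((j + 1) * 2 ^ k : ℕ) : ℝ) * a := h3
    _ ≤ (n + 2 ^ k) * a := mul_le_mul_of_nonneg_right h4 ha
    _ ≤ n * a + 2 ^ k * (M * ε) := by rw [add_mul]; gcongr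
    _ = n * a + (M * 2 ^ k) * ε := by ring
    _ ≤ n * a + n * ε := by gcongr
    _ = n * (a + ε) := by ring

/-- A non-negative sequence that satisfies `b (k + 1) ≤ b k / 2 + s k` with a summable
`s` is summable. -/
theorem summable_of_le_half_add {b s : ℕ → ℝ} (hb : ∀ k, 0 ≤ b k) (hs0 : ∀ k, 0 ≤ s k)
    (hs : Summable s) (h : ∀ k, b (k + 1) ≤ b k / 2 + s k) : Summable b := by
  refine summable_of_sum_range_le (c := 2 * (b 0 + ∑' k, s k)) hb fun n => ?_
  have h1 : ∀ n, ∑ k ∈ Finset.range (n + 1), b k ≤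
      b 0 + (∑ k ∈ Finset.range n, b k) / 2 + ∑ k ∈ Finset.range n, s k := by
    intro n
    rw [Finset.sum_range_succ', Finset.sum_div]
    have := Finset.sum_le_sum fun k (_ : k ∈ Finset.range n) => h k
    rw [Finset.sum_add_distrib] at this
    linarith
  have h2 := h1 n
  rw [Finset.sum_range_succ] at h2
  have h3 := hs.sum_le_tsum (Finset.range n) fun k _ => hs0 k
  linarith [hb n]

namespace StrongLawSetting

variable {X : ℕ → Ω → ℝ} (h : StrongLawSetting S X)

include h

/-- A Fuk–Nagaev type tail bound for sums of bounded non-negative variables: the exponential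
Chebyshev inequality at the parameter `log (1 + y ^ 2 / B) / y`. -/
theorem cap_sum_ge_le {g : ℝ → ℝ} (hg : BddLip g) {y : ℝ} (hy : 0 < y) (h0 : ∀ x, 0 ≤ g x)
    (hgy : ∀ x, g x ≤ y) (n : ℕ) {B : ℝ} (hB : 0 < B)
    (hnB : n * S.ev (fun ω => g (X 0 ω) ^ 2) ≤ B) :
    S.cap {ω | n * S.ev (fun ω => g (X 0 ω)) + y ≤ ∑ i ∈ Finset.range n, g (X i ω)} ≤
      Real.exp 1 * B / y ^ 2 := by
  set m := S.ev (fun ω => g (X 0 ω)) with hm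
  set s := S.ev (fun ω => g (X 0 ω) ^ 2) with hs
  set l := Real.log (1 + y ^ 2 / B) / y with hl
  have hpos : 0 < 1 + y ^ 2 / B := by positivity
  have hl0 : 0 ≤ l := div_nonneg (Real.log_nonneg (by
    have : 0 ≤ y ^ 2 / B := by positivity
    linarith)) hy.le
  have hly : Real.exp (l * y) = 1 + y ^ 2 / B := by
    rw [hl, div_mul_cancel₀ _ hy.ne', Real.exp_log hpos]
  have hψ : BddLip (fun x => Real.exp (l * g x)) :=
    hg.contDiff_comp (g := fun t => Real.exp (l * t)) (by fun_prop)
  have hg2 : BddLip (fun x => g x ^ 2) := hg.contDiff_comp (g := fun t => t ^ 2) (by fun_prop)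
  have fg := hg.finiteMean (h.mem 0)
  have fg2 := hg2.finiteMean (h.mem 0)
  have hpt : ∀ x, Real.exp (l * g x) ≤ (l * g x + 1 / B * g x ^ 2) + 1 := by
    intro x
    have h1 := exp_mul_sub_le (t := g x / y) (a := l * y) (div_nonneg (h0 x) hy.le)
      ((div_le_one hy).2 (hgy x)) (by positivity)
    have h2 : g x / y * (l * y) = l * g x := by field_simp
    rw [h2, hly] at h1
    have h3 : (g x / y) ^ 2 * (1 + y ^ 2 / B - 1 - l * y) ≤ (g x / y) ^ 2 * (y ^ 2 / B) := by
      refine mul_le_mul_of_nonneg_left ?_ (by positivity)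
      have : 0 ≤ l * y := by positivity
      linarith
    have h4 : (g x / y) ^ 2 * (y ^ 2 / B) = 1 / B * g x ^ 2 := by field_simp
    linarith
  have hmgf : S.ev (fun ω => Real.exp (l * g (X 0 ω))) ≤ Real.exp (l * m + s / B) := by
    have f1 := fg.const_mul l
    have f2 := fg2.const_mul (1 / B)
    have h1 := ev_mono (hψ.finiteMean (h.mem 0)) ((f1.add f2).add (FiniteMean.const 1))
      fun ω => hpt (X 0 ω)
    have h2 := ev_add_le f1 f2
    rw [ev_add_const (f1.add f2)] at h1
    rw [ev_const_mul fg hl0, ev_const_mul fg2 (by positivity)] at h2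
    have h3 := Real.add_one_le_exp (l * m + s / B)
    have h4 : 1 / B * s = s / B := by ring
    linarith
  have hprod := h.prod _ hψ (fun x => (Real.exp_pos _).le) n
  have fprod : FiniteMean S (fun ω => ∏ i ∈ Finset.range n, Real.exp (l * g (X i ω))) := by
    obtain ⟨M, hM⟩ := hψ.2
    exact finiteMean_prod _ (fun i => comp_mem_one (h.mem i) hψ.locLip) fun i ω => hM _
  have hcheb := cap_le_ev (S := S)
    (A := {ω | n * m + y ≤ ∑ i ∈ Finset.range n, g (X i ω)})
    (fprod.const_mul (Real.exp (-(l * (n * m + y)))))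
    (fun ω => mul_nonneg (Real.exp_pos _).le (Finset.prod_nonneg fun i _ => (Real.exp_pos _).le))
    (fun ω hω => by
      rw [← Real.exp_sum, ← Real.exp_add, ← Finset.mul_sum]
      refine Real.one_le_exp ?_
      have hω' : n * m + y ≤ ∑ i ∈ Finset.range n, g (X i ω) := hω
      have := mul_le_mul_of_nonneg_left hω' hl0
      linarith)
  rw [ev_const_mul fprod (Real.exp_pos _).le, hprod] at hcheb
  have hpow : S.ev (fun ω => Real.exp (l * g (X 0 ω))) ^ n ≤ Real.exp (n * (l * m) + 1) := by
    refine (pow_le_pow_left₀ (ev_nonneg (hψ.finiteMean (h.mem 0)) fun ω => (Real.exp_pos _).le)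
      hmgf n).trans ?_
    rw [← Real.exp_nat_mul]
    refine Real.exp_le_exp.2 ?_
    have : n * (s / B) ≤ 1 := by rw [← mul_div_assoc]; exact (div_le_one hB).2 hnB
    linarith
  calc _ ≤ _ := hcheb
    _ ≤ Real.exp (-(l * (n * m + y))) * Real.exp (n * (l * m) + 1) := by gcongr
    _ = Real.exp 1 / Real.exp (l * y) := by
        rw [← Real.exp_add, ← Real.exp_sub]; congr 1; ring
    _ ≤ Real.exp 1 / (y ^ 2 / B) := by
        rw [hly]
        exact div_le_div_of_nonneg_left (Real.exp_pos _).le (by positivity) (by linarith)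
    _ = Real.exp 1 * B / y ^ 2 := by field_simp

variable {f : ℝ → ℝ} {K : NNReal} {c : ℝ} (hf : LipschitzWith K f) (hf0 : ∀ x, 0 ≤ f x)
  (hfc : ∀ x, f x ≤ |x| + c) {r : ℝ} (hr : 0 < r)

include hf hfc hr

/-- The dyadic tail series of `f (X 0)`, with the indicators of `{f (X 0) > r * 2 ^ k}` replaced by
Lipschitz majorants, so that each term is the same for all `X i`. -/
theorem summable_tail : Summable fun k : ℕ =>
    (2 : ℝ) ^ k * S.ev (fun ω => ramp (2 / (r * 2 ^ k) * f (X 0 ω) + -1)) := by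
  refine Summable.of_norm_bounded_eventually_nat (h.tail (r / 4) (by positivity)) ?_
  have h1 : Tendsto (fun k : ℕ => r / 4 * (2 : ℝ) ^ k) atTop atTop :=
    (tendsto_pow_atTop_atTop_of_one_lt one_lt_two).const_mul_atTop (by positivity)
  filter_upwards [h1.eventually_ge_atTop c] with k hk
  have hb := (hf.bddLip_ramp (2 / (r * 2 ^ k)) (-1)).finiteMean (h.mem 0)
  rw [Real.norm_of_nonneg (mul_nonneg (by positivity) (ev_nonneg hb fun ω => ramp_nonneg _))]
  refine mul_le_mul_of_nonneg_left (ev_le_cap hb (fun ω => ramp_le_one _) fun ω hω => ?_)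
    (by positivity)
  refine (ramp_of_nonpos ?_).le
  have h2 : |X 0 ω| < r / 4 * 2 ^ k := not_le.1 hω
  have h3 := hfc (X 0 ω)
  have h4 : f (X 0 ω) ≤ r * 2 ^ k / 2 := by linarith
  have h5 : 2 / (r * 2 ^ k) * f (X 0 ω) ≤ 2 / (r * 2 ^ k) * (r * 2 ^ k / 2) := by gcongr
  have h6 : 2 / (r * 2 ^ k) * (r * 2 ^ k / 2) = 1 := by field_simp
  linarith

/-- Raising the truncation level from `r * 2 ^ k` to `r * 2 ^ (k + 1)` changes the second moment by
at most `(r * 2 ^ (k + 1)) ^ 2` times a tail term, so the tail series controls these moments. -/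
theorem summable_truncated_second_moment : Summable fun k : ℕ =>
    S.ev (fun ω => max 0 (min (r * 2 ^ k) (f (X 0 ω))) ^ 2) / 2 ^ k := by
  have hb : ∀ k : ℕ, BddLip (fun x => max 0 (min (r * 2 ^ k) (f x)) ^ 2) := fun k =>
    (hf.bddLip_clamp 0 (r * 2 ^ k)).contDiff_comp (g := fun t => t ^ 2) (by fun_prop)
  have hτ : ∀ k : ℕ, BddLip (fun x => ramp (2 / (r * 2 ^ k) * f x + -1)) := fun k =>
    hf.bddLip_ramp _ _
  refine summable_of_le_half_add
    (s := fun k => 2 * r ^ 2 * (2 ^ k * S.ev (fun ω => ramp (2 / (r * 2 ^ k) * f (X 0 ω) + -1))))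
    (fun k => ?_) (fun k => ?_) ((h.summable_tail hf hfc hr).mul_left _) fun k => ?_
  · exact div_nonneg (ev_nonneg ((hb k).finiteMean (h.mem 0)) fun ω => by positivity)
      (by positivity)
  · have := ev_nonneg ((hτ k).finiteMean (h.mem 0)) fun ω => ramp_nonneg _
    positivity
  · have hpt : ∀ x, max 0 (min (r * 2 ^ (k + 1)) (f x)) ^ 2 ≤
        max 0 (min (r * 2 ^ k) (f x)) ^ 2 +
          (r * 2 ^ (k + 1)) ^ 2 * ramp (2 / (r * 2 ^ k) * f x + -1) := by
      intro x
      have hle : max 0 (min (r * 2 ^ (k + 1)) (f x)) ≤ r * 2 ^ (k + 1) :=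
        max_le (by positivity) (min_le_left _ _)
      have hnn : 0 ≤ max 0 (min (r * 2 ^ (k + 1)) (f x)) := le_max_left _ _
      rcases le_total (f x) (r * 2 ^ k) with hx | hx
      · have h1 : f x ≤ r * 2 ^ (k + 1) := hx.trans (by
          rw [pow_succ]; nlinarith [show (0 : ℝ) < r * 2 ^ k by positivity])
        rw [min_eq_right hx, min_eq_right h1]
        have := ramp_nonneg (2 / (r * 2 ^ k) * f x + -1)
        exact le_add_of_nonneg_right (by positivity)
      · have h1 : 2 / (r * 2 ^ k) * (r * 2 ^ k) ≤ 2 / (r * 2 ^ k) * f x := by gcongr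
        have h2 : 2 / (r * 2 ^ k) * (r * 2 ^ k) = 2 := by field_simp
        rw [ramp_of_one_le (by linarith), mul_one]
        have := pow_le_pow_left₀ hnn hle 2
        have := sq_nonneg (max 0 (min (r * 2 ^ k) (f x)))
        linarith
    have f1 := (hb k).finiteMean (h.mem 0)
    have f2 := (hτ k).finiteMean (h.mem 0)
    have h1 := (ev_mono ((hb (k + 1)).finiteMean (h.mem 0)) (f1.add (f2.const_mul _))
      fun ω => hpt (X 0 ω)).trans (ev_add_le f1 (f2.const_mul _))
    rw [ev_const_mul f2 (by positivity)] at h1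
    rw [div_le_iff₀ (by positivity)]
    refine h1.trans (le_of_eq ?_)
    rw [add_mul]
    congr 1
    · rw [pow_succ]; field_simp
    · ring

omit hr

include hf0

/-- The upper half of the strong law for `∑ f (X i)` with `f ≥ 0`. -/
theorem cap_not_eventually_sum_le {μ : ℝ}
    (hμ : ∀ y : ℝ, 0 < y → S.ev (fun ω => max 0 (min y (f (X 0 ω)))) ≤ μ) {ε : ℝ} (hε : 0 < ε) :
    S.cap {ω | ¬ ∀ᶠ n : ℕ in atTop, ∑ i ∈ Finset.range n, f (X i ω) ≤ n * (μ + ε)} = 0 := by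
  have hμ0 : 0 ≤ μ := (ev_nonneg ((hf.bddLip_clamp 0 1).finiteMean (h.mem 0))
    fun ω => le_max_left _ _).trans (hμ 1 one_pos)
  set δ := ε / 2 with hδ
  have hδ0 : 0 < δ := half_pos hε
  have hmeas : ∀ n : ℕ, MeasurableSet
      {ω | n * (μ + δ) < ∑ i ∈ Finset.range n, f (X i ω)} := fun n =>
    measurableSet_lt measurable_const (Finset.measurable_sum _ fun i _ =>
      hf.continuous.measurable.comp (h.measurable i))
  have hdy : ∀ m : ℕ, S.cap {ω | ∃ᶠ k : ℕ in atTop, (((m + 1) * 2 ^ k : ℕ) : ℝ) * (μ + δ) <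
      ∑ i ∈ Finset.range ((m + 1) * 2 ^ k), f (X i ω)} = 0 := by
    intro m
    refine h.cont.cap_frequently_eq_zero (fun k => hmeas _) ?_
    -- `r * 2 ^ k = n * δ` for `n = (m + 1) * 2 ^ k`: truncation at the size of the deviation
    set r := δ * (m + 1) with hr
    have hr0 : 0 < r := by positivity
    have hsum := ((h.summable_tail hf hfc hr0).mul_left ((m : ℝ) + 1)).add
      (((h.summable_truncated_second_moment hf hfc hr0).add
        (summable_geometric_two)).mul_left (Real.exp 1 * (m + 1) / r ^ 2))
    refine Summable.of_nonneg_of_le (fun k => S.cap_nonneg _) (fun k => ?_) hsum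
    set n := (m + 1) * 2 ^ k with hn
    have hnr : (n : ℝ) = (m + 1) * 2 ^ k := by rw [hn]; push_cast; ring
    set y := r * 2 ^ k with hy
    have hy0 : 0 < y := by positivity
    have hyn : y = n * δ := by rw [hnr, hy, hr]; ring
    have hn0 : 0 < (n : ℝ) := by rw [hnr]; positivity
    set g : ℝ → ℝ := fun x => max 0 (min y (f x)) with hg
    have hgb : BddLip g := hf.bddLip_clamp 0 y
    have hg2 : BddLip (fun x => g x ^ 2) := hgb.contDiff_comp (g := fun t => t ^ 2) (by fun_prop)
    set b := S.ev (fun ω => g (X 0 ω) ^ 2) with hb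
    have hb0 : 0 ≤ b := ev_nonneg (hg2.finiteMean (h.mem 0)) fun ω => by positivity
    have hcher := h.cap_sum_ge_le hgb hy0 (fun x => le_max_left _ _)
      (fun x => max_le hy0.le (min_le_left _ _)) n (B := n * (b + 1)) (by positivity)
      (by rw [← hb]; nlinarith)
    have htail : ∀ i ∈ Finset.range n, S.cap {ω | y < f (X i ω)} ≤
        S.ev (fun ω => ramp (2 / y * f (X 0 ω) + -1)) := by
      intro i _
      have hτ := hf.bddLip_ramp (2 / y) (-1)
      rw [← h.ident _ hτ i]
      refine cap_le_ev (hτ.finiteMean (h.mem i)) (fun ω => ramp_nonneg _) fun ω hω => ?_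
      refine (ramp_of_one_le ?_).ge
      have h1 : 2 / y * y ≤ 2 / y * f (X i ω) :=
        mul_le_mul_of_nonneg_left (le_of_lt hω) (by positivity)
      rw [div_mul_cancel₀ _ hy0.ne'] at h1
      linarith
    have hsub : {ω | (n : ℝ) * (μ + δ) < ∑ i ∈ Finset.range n, f (X i ω)} ⊆
        (⋃ i ∈ Finset.range n, {ω | y < f (X i ω)}) ∪
        {ω | n * S.ev (fun ω => g (X 0 ω)) + y ≤ ∑ i ∈ Finset.range n, g (X i ω)} := by
      intro ω hω
      by_cases hex : ∃ i ∈ Finset.range n, y < f (X i ω)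
      · obtain ⟨i, hi, hlt⟩ := hex
        exact Or.inl (Set.mem_biUnion hi hlt)
      · push Not at hex
        refine Or.inr ?_
        have h1 : ∑ i ∈ Finset.range n, g (X i ω) = ∑ i ∈ Finset.range n, f (X i ω) :=
          Finset.sum_congr rfl fun i hi => by
            rw [hg]; dsimp only; rw [min_eq_right (hex i hi), max_eq_right (hf0 _)]
        have h2 : (n : ℝ) * S.ev (fun ω => g (X 0 ω)) ≤ n * μ := by gcongr; exact hμ y hy0
        have h3 : (n : ℝ) * (μ + δ) < ∑ i ∈ Finset.range n, f (X i ω) := hω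
        change n * S.ev (fun ω => g (X 0 ω)) + y ≤ ∑ i ∈ Finset.range n, g (X i ω)
        rw [h1, hyn]
        linarith
    have h1 := (cap_mono (S := S) hsub).trans (cap_union_le _ _)
    have h2 := (cap_biUnion_le (S := S) (Finset.range n) fun i => {ω | y < f (X i ω)}).trans
      (Finset.sum_le_sum htail)
    rw [Finset.sum_const, Finset.card_range, nsmul_eq_mul] at h2
    refine h1.trans ((add_le_add h2 hcher).trans (le_of_eq ?_))
    rw [hnr, hy]
    congr 1
    · ring
    · have : ((1 : ℝ) / 2) ^ k = 1 / 2 ^ k := by rw [div_pow, one_pow]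
      rw [this]
      field_simp
  refine cap_eq_zero_of_subset (h.cont.cap_iUnion_eq_zero (fun m =>
    measurableSet_frequently fun k => hmeas _) hdy) fun ω hω => ?_
  by_contra hcon
  refine hω ?_
  have hmono : Monotone fun n : ℕ => ∑ i ∈ Finset.range n, f (X i ω) :=
    monotone_nat_of_le_succ fun n => by
      rw [Finset.sum_range_succ]
      exact le_add_of_nonneg_right (hf0 _)
  have := eventually_le_of_dyadic hmono (a := μ + δ) hδ0 (by positivity) fun m hm => by
    by_contra hnot
    refine hcon (Set.mem_iUnion.2 ⟨m - 1, ?_⟩)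
    rw [Nat.sub_add_cancel hm]
    exact (not_eventually.1 hnot).mono fun k hk => not_le.1 hk
  refine this.mono fun n hn => hn.trans (le_of_eq ?_)
  rw [hδ]; ring

end StrongLawSetting

/-! ### Lower bounds for the capacity of deviations -/

theorem ev_le_add_mul_cap {U W : Ω → ℝ} (hU : FiniteMean S U) (hW : FiniteMean S W) {b : ℝ}
    (hb : 0 ≤ b) {A : Set Ω} (hA : ∀ ω ∈ A, U ω ≤ W ω + b) (hA' : ∀ ω ∉ A, U ω ≤ W ω) :
    S.ev U ≤ S.ev W + b * S.cap A := by
  refine le_of_forall_pos_le_add fun ε hε => ?_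
  obtain ⟨ξ, hξ, h0, h1, h2⟩ := exists_ev_lt_cap_add (S := S) A (ε := ε / (b + 1)) (by positivity)
  have h3 := (ev_mono hU (hW.add (hξ.const_mul b)) fun ω => by
    by_cases hω : ω ∈ A
    · nlinarith [hA ω hω, h1 ω hω]
    · linarith [hA' ω hω, mul_nonneg hb (h0 ω)]).trans (ev_add_le hW (hξ.const_mul b))
  rw [ev_const_mul hξ hb] at h3
  have h4 : b * S.ev ξ ≤ b * (S.cap A + ε / (b + 1)) := mul_le_mul_of_nonneg_left h2.le hb
  have h5 : b * (ε / (b + 1)) ≤ ε := by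
    rw [← mul_div_assoc, div_le_iff₀ (by positivity)]
    nlinarith
  linarith

/-- The pointwise inequality that converts convergence of exponential moments to `1` into a lower
bound for the capacity of `{z > -ε}`. The three terms on the right take care of `z ≤ -ε`,
of `-ε < z ≤ l⁻²` and of `z > l⁻²`. -/
theorem exp_le_three_terms {l ε z : ℝ} (hl : 0 < l) :
    (z ≤ -ε → Real.exp (l * z) ≤ Real.exp (-l) * Real.exp ((l + l ^ 3) * z) + Real.exp (-(l * ε))) ∧
    Real.exp (l * z) ≤ Real.exp (-l) * Real.exp ((l + l ^ 3) * z) + Real.exp (1 / l) := by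
  refine ⟨fun hz => ?_, ?_⟩
  · have h1 : Real.exp (l * z) ≤ Real.exp (-(l * ε)) := Real.exp_le_exp.2 (by nlinarith)
    have h2 : 0 < Real.exp (-l) * Real.exp ((l + l ^ 3) * z) := by positivity
    linarith
  · rcases le_or_gt z (1 / l ^ 2) with hz | hz
    · have h1 : Real.exp (l * z) ≤ Real.exp (1 / l) := by
        refine Real.exp_le_exp.2 ?_
        calc l * z ≤ l * (1 / l ^ 2) := by gcongr
          _ = 1 / l := by field_simp
      have h2 : 0 < Real.exp (-l) * Real.exp ((l + l ^ 3) * z) := by positivity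
      linarith
    · have h1 : Real.exp (l * z) ≤ Real.exp (-l) * Real.exp ((l + l ^ 3) * z) := by
        rw [← Real.exp_add]
        refine Real.exp_le_exp.2 ?_
        have : l ^ 3 * (1 / l ^ 2) ≤ l ^ 3 * z := by gcongr
        have h3 : l ^ 3 * (1 / l ^ 2) = l := by field_simp
        linarith
      linarith [Real.exp_pos (1 / l)]

namespace StrongLawSetting

variable {X : ℕ → Ω → ℝ} (h : StrongLawSetting S X)

include h

/-- Exponential moments of the centred means: independence gives an `n`-th power of an
exponential moment at the parameter `l / n`, which is `1 + l * m / n + O(1 / n ^ 2)`. -/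
theorem tendsto_ev_exp {g : ℝ → ℝ} (hg : BddLip g) {l : ℝ} (hl : 0 ≤ l) :
    Tendsto (fun n : ℕ => S.ev (fun ω => Real.exp (l * ((∑ i ∈ Finset.range n, g (X i ω)) / n -
      S.ev (fun ω => g (X 0 ω)))))) atTop (𝓝 1) := by
  set m := S.ev (fun ω => g (X 0 ω)) with hm
  obtain ⟨M, hM⟩ := hg.2
  have hM0 : 0 ≤ M := (abs_nonneg _).trans (hM 0)
  have hψ : ∀ n : ℕ, BddLip (fun x => Real.exp (l / n * g x)) := fun n =>
    hg.contDiff_comp (g := fun t => Real.exp (l / n * t)) (by fun_prop)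
  have fg := hg.finiteMean (h.mem 0)
  set a : ℕ → ℝ := fun n => S.ev (fun ω => Real.exp (l / n * g (X 0 ω))) with ha
  have hrew : ∀ n : ℕ, S.ev (fun ω => Real.exp (l * ((∑ i ∈ Finset.range n, g (X i ω)) / n - m)))
      = Real.exp (-(l * m)) * a n ^ n := by
    intro n
    obtain ⟨M', hM'⟩ := (hψ n).2
    rw [ha]
    dsimp only
    rw [← h.prod _ (hψ n) (fun x => (Real.exp_pos _).le) n, ← ev_const_mul
      (finiteMean_prod _ (fun i => comp_mem_one (h.mem i) (hψ n).locLip) fun i ω => hM' _)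
      (Real.exp_pos _).le]
    congr 1
    ext ω
    rw [← Real.exp_sum, ← Real.exp_add, ← Finset.mul_sum]
    congr 1
    ring
  have hlow : ∀ n : ℕ, 1 + l * m / n ≤ a n := by
    intro n
    have hln : 0 ≤ l / n := by positivity
    have h1 := ev_mono ((fg.const_mul (l / n)).add (FiniteMean.const 1))
      ((hψ n).finiteMean (h.mem 0)) fun ω => Real.add_one_le_exp _
    rw [ev_add_const (fg.const_mul _), ev_const_mul fg hln] at h1
    calc 1 + l * m / n = l / n * m + 1 := by ring
      _ ≤ a n := h1
  have hup : ∀ᶠ n : ℕ in atTop, a n ^ n ≤ Real.exp (l * m + (l * M) ^ 2 / n) := by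
    filter_upwards [eventually_ge_atTop 1, tendsto_natCast_atTop_atTop.eventually_ge_atTop (l * M)]
      with n hn1 hn
    have hn0 : (0 : ℝ) < n := by exact_mod_cast hn1
    have hln : 0 ≤ l / n := by positivity
    have hpt : ∀ x, Real.exp (l / n * g x) ≤ l / n * g x + (1 + (l * M / n) ^ 2) := by
      intro x
      have h1 : |l / n * g x| ≤ l * M / n := by
        rw [abs_mul, abs_of_nonneg hln, div_mul_eq_mul_div]
        gcongr
        exact hM x
      have h2 := (abs_le.1 (Real.abs_exp_sub_one_sub_id_le
        (h1.trans ((div_le_one hn0).2 hn)))).2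
      have h3 : (l / n * g x) ^ 2 ≤ (l * M / n) ^ 2 := sq_le_sq' (abs_le.1 h1).1 (abs_le.1 h1).2
      linarith
    have h1 := ev_mono ((hψ n).finiteMean (h.mem 0)) ((fg.const_mul (l / n)).add
      (FiniteMean.const _)) fun ω => hpt (X 0 ω)
    rw [ev_add_const (fg.const_mul _), ev_const_mul fg hln] at h1
    have h2 : a n ≤ Real.exp (l / n * m + (l * M / n) ^ 2) := by
      have := Real.add_one_le_exp (l / n * m + (l * M / n) ^ 2)
      exact h1.trans (by linarith)
    have h3 := pow_le_pow_left₀ (ev_nonneg ((hψ n).finiteMean (h.mem 0))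
      fun ω => (Real.exp_pos _).le) h2 n
    refine h3.trans (le_of_eq ?_)
    rw [← Real.exp_nat_mul]
    congr 1
    field_simp
  have hlim : Tendsto (fun n : ℕ => a n ^ n) atTop (𝓝 (Real.exp (l * m))) := by
    have h1 : Tendsto (fun n : ℕ => Real.exp (l * m + (l * M) ^ 2 / n)) atTop
        (𝓝 (Real.exp (l * m))) := by
      have := (tendsto_const_div_atTop_nhds_zero_nat ((l * M) ^ 2)).const_add (l * m)
      rw [add_zero] at this
      exact (Real.continuous_exp.tendsto _).comp this
    refine tendsto_of_tendsto_of_tendsto_of_le_of_le' (Real.tendsto_one_add_div_pow_exp (l * m)) h1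
      ?_ hup
    have h2 := (tendsto_const_div_atTop_nhds_zero_nat (l * m)).const_add 1
    rw [add_zero] at h2
    filter_upwards [h2.eventually_const_lt one_pos] with n hn
    exact pow_le_pow_left₀ hn.le (hlow n) n
  simp only [hrew]
  have := hlim.const_mul (Real.exp (-(l * m)))
  rwa [← Real.exp_add, neg_add_cancel, Real.exp_zero] at this

theorem tendsto_cap_mean_gt {g : ℝ → ℝ} (hg : BddLip g) {ε : ℝ} (hε : 0 < ε) :
    Tendsto (fun n : ℕ => S.cap {ω | S.ev (fun ω => g (X 0 ω)) - ε <
      (∑ i ∈ Finset.range n, g (X i ω)) / n}) atTop (𝓝 1) := by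
  set m := S.ev (fun ω => g (X 0 ω)) with hm
  refine tendsto_order.2 ⟨fun a ha => ?_, fun a ha => Eventually.of_forall fun n =>
    (S.cap_le_one _).trans_lt ha⟩
  -- the lower bound for the capacity that the parameter `l` yields as `n → ∞`
  have hlim : Tendsto (fun l : ℝ => Real.exp (-(1 / l)) *
      (1 - Real.exp (-l) - Real.exp (-(l * ε)))) atTop (𝓝 1) := by
    have h1 : Tendsto (fun l : ℝ => Real.exp (-(1 / l))) atTop (𝓝 1) := by
      have : Tendsto (fun l : ℝ => -(1 / l)) atTop (𝓝 (-0)) := by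
        simpa only [one_div] using (tendsto_inv_atTop_zero (𝕜 := ℝ)).neg
      rw [neg_zero] at this
      simpa [Function.comp_def] using (Real.continuous_exp.tendsto 0).comp this
    have h2 : Tendsto (fun l : ℝ => Real.exp (-l)) atTop (𝓝 0) :=
      Real.tendsto_exp_neg_atTop_nhds_zero
    have h3 : Tendsto (fun l : ℝ => Real.exp (-(l * ε))) atTop (𝓝 0) :=
      h2.comp (tendsto_id.atTop_mul_const hε)
    simpa using h1.mul ((tendsto_const_nhds.sub h2).sub h3)
  obtain ⟨l, hla, hl⟩ := ((hlim.eventually_const_lt ha).and (eventually_gt_atTop 0)).exists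
  have hb1 := h.tendsto_ev_exp hg hl.le
  have hb2 := h.tendsto_ev_exp hg (l := l + l ^ 3) (by positivity)
  rw [← hm] at hb1 hb2
  have hb := (((hb1.sub (hb2.const_mul (Real.exp (-l)))).sub_const
    (Real.exp (-(l * ε)))).const_mul (Real.exp (-(1 / l))))
  rw [mul_one] at hb
  filter_upwards [hb.eventually_const_lt hla] with n hn
  refine hn.trans_le ?_
  obtain ⟨M, hM⟩ := hg.2
  have hfin : ∀ t : ℝ, FiniteMean S
      (fun ω => Real.exp (t * ((∑ i ∈ Finset.range n, g (X i ω)) / n - m))) := by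
    intro t
    have hψ : BddLip (fun x => Real.exp (t / n * g x)) :=
      hg.contDiff_comp (g := fun s => Real.exp (t / n * s)) (by fun_prop)
    obtain ⟨M', hM'⟩ := hψ.2
    have := (finiteMean_prod (Finset.range n) (fun i => comp_mem_one (h.mem i) hψ.locLip)
      fun i ω => hM' _).const_mul (Real.exp (-(t * m)))
    convert this using 2 with ω
    rw [← Real.exp_sum, ← Real.exp_add, ← Finset.mul_sum]
    congr 1
    ring
  have hkey := ev_le_add_mul_cap (S := S) (b := Real.exp (1 / l))
    (A := {ω | m - ε < (∑ i ∈ Finset.range n, g (X i ω)) / n}) (hfin l)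
    (((hfin (l + l ^ 3)).const_mul (Real.exp (-l))).add
      (FiniteMean.const (Real.exp (-(l * ε))))) (Real.exp_pos _).le
    (fun ω _ => by
      have := (exp_le_three_terms (ε := ε)
        (z := (∑ i ∈ Finset.range n, g (X i ω)) / n - m) hl).2
      linarith [Real.exp_pos (-(l * ε))])
    (fun ω hω => by
      have hω' : (∑ i ∈ Finset.range n, g (X i ω)) / n ≤ m - ε := not_lt.1 hω
      exact (exp_le_three_terms hl).1 (by linarith))
  rw [ev_add_const ((hfin _).const_mul _), ev_const_mul (hfin _) (Real.exp_pos _).le] at hkey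
  have h1 : Real.exp (-(1 / l)) * Real.exp (1 / l) = 1 := by
    rw [← Real.exp_add, neg_add_cancel, Real.exp_zero]
  calc _ ≤ Real.exp (-(1 / l)) * (Real.exp (1 / l) *
        S.cap {ω | m - ε < (∑ i ∈ Finset.range n, g (X i ω)) / n}) := by
        refine mul_le_mul_of_nonneg_left ?_ (Real.exp_pos _).le
        linarith
    _ = _ := by rw [← mul_assoc, h1, one_mul]

/-! ### Deviations of the partial sums -/

theorem measurable_partialSum (n : ℕ) : Measurable (partialSum X n) :=
  Finset.measurable_sum _ fun i _ => h.measurable i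

/-- The excesses over a high level contribute little to the sums. -/
theorem exists_excess_bound {ε : ℝ} (hε : 0 < ε) : ∃ c : ℝ, 0 ≤ c ∧
    FiniteMean S (fun ω => max (|X 0 ω| - c) 0) ∧ S.ev (fun ω => max (|X 0 ω| - c) 0) ≤ ε ∧
    S.cap {ω | ¬ ∀ᶠ n : ℕ in atTop,
      ∑ i ∈ Finset.range n, max (|X i ω| - c) 0 ≤ n * (2 * ε)} = 0 := by
  obtain ⟨c, hc, hf, he⟩ := h.unif ε hε
  refine ⟨c, hc, hf, he, ?_⟩
  have hlip := ((lipschitzWith_one_norm (E := ℝ)).sub (LipschitzWith.const c)).max_const 0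
  have := h.cap_not_eventually_sum_le (f := fun x => max (|x| - c) 0) (c := 0) hlip
    (fun x => le_max_right _ _) (fun x => max_le (by linarith) (by positivity)) (μ := ε)
    (fun y hy => (ev_mono ((hlip.bddLip_clamp 0 y).finiteMean (h.mem 0)) hf fun ω =>
      max_le (le_max_right _ _) (min_le_right _ _)).trans he) hε
  rwa [← two_mul] at this

theorem cap_not_eventually_partialSum_le {ε : ℝ} (hε : 0 < ε) :
    S.cap {ω | ¬ ∀ᶠ n : ℕ in atTop, partialSum X n ω ≤ n * (S.ev (X 0) + ε)} = 0 := by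
  set δ := ε / 2 with hδ
  have hδ0 : 0 < δ := half_pos hε
  obtain ⟨c, hc, hf, he⟩ := h.unif δ hδ0
  have hlip : LipschitzWith (1 + 0) (fun x : ℝ => max x (-c) + c) :=
    (LipschitzWith.id.max_const (-c)).add (LipschitzWith.const c)
  have hnn : ∀ x : ℝ, 0 ≤ max x (-c) + c := fun x => by linarith [le_max_right x (-c)]
  have hle : ∀ x : ℝ, max x (-c) + c ≤ |x| + c := fun x => by
    have : max x (-c) ≤ |x| := max_le (le_abs_self _) (by linarith [abs_nonneg x])
    linarith
  have hfX := h.finiteMean_zero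
  have hle' : ∀ x : ℝ, max x (-c) ≤ x + max (|x| - c) 0 := fun x => max_le
    (by linarith [le_max_right (|x| - c) 0])
    (by linarith [le_max_left (|x| - c) 0, neg_abs_le x])
  have hU := h.cap_not_eventually_sum_le hlip hnn hle (μ := S.ev (X 0) + δ + c)
    (fun y hy => by
      have h1 := ev_mono ((hlip.bddLip_clamp 0 y).finiteMean (h.mem 0))
        ((hfX.add hf).add (FiniteMean.const c)) fun ω => by
          refine max_le ((hnn (X 0 ω)).trans ?_) ((min_le_right _ _).trans ?_) <;>
          linarith [hle' (X 0 ω)]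
      rw [ev_add_const (hfX.add hf)] at h1
      linarith [ev_add_le hfX hf]) hδ0
  refine cap_eq_zero_of_subset hU fun ω hω hcon => hω (hcon.mono fun n hn => ?_)
  have h1 : partialSum X n ω + n * c ≤ ∑ i ∈ Finset.range n, (max (X i ω) (-c) + c) := by
    rw [Finset.sum_add_distrib, Finset.sum_const, Finset.card_range, nsmul_eq_mul]
    exact add_le_add_left (Finset.sum_le_sum fun i _ => le_max_left _ _) _
  have h2 : (n : ℝ) * (S.ev (X 0) + δ + c + δ) = n * (S.ev (X 0) + ε) + n * c := by rw [hδ]; ring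
  linarith

theorem cap_not_eventually_abs_le {ε : ℝ} (hε : 0 < ε) :
    S.cap {ω | ¬ ∀ᶠ n : ℕ in atTop, |X n ω| ≤ (n + 1) * ε} = 0 := by
  obtain ⟨c, hc, -, -, hU⟩ := h.exists_excess_bound (ε := ε / 3) (by positivity)
  refine cap_eq_zero_of_subset hU fun ω hω hcon => hω ?_
  have h1 := (tendsto_add_atTop_nat 1).eventually hcon
  have h2 : Tendsto (fun n : ℕ => (n : ℝ) * (ε / 3)) atTop atTop :=
    tendsto_natCast_atTop_atTop.atTop_mul_const (by positivity)
  filter_upwards [h1, h2.eventually_ge_atTop c] with n hn hnc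
  rw [Finset.sum_range_succ] at hn
  have h3 : 0 ≤ ∑ i ∈ Finset.range n, max (|X i ω| - c) 0 :=
    Finset.sum_nonneg fun i _ => le_max_right _ _
  have h4 := le_max_left (|X n ω| - c) 0
  push_cast at hn
  linarith

/-- The weak lower bound: the means exceed `E[X 0] - ε` with capacity tending to `1`. -/
theorem tendsto_cap_partialSum_gt {ε : ℝ} (hε : 0 < ε) :
    Tendsto (fun n : ℕ => S.cap {ω | n * (S.ev (X 0) - ε) < partialSum X n ω}) atTop (𝓝 1) := by
  set δ := ε / 4 with hδ
  have hδ0 : 0 < δ := by positivity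
  obtain ⟨c, hc, hf, he, hU⟩ := h.exists_excess_bound hδ0
  have hg : BddLip (fun x : ℝ => max (-c) (min c x)) := LipschitzWith.id.bddLip_clamp (-c) c
  have hpt : ∀ x : ℝ, max (-c) (min c x) - max (|x| - c) 0 ≤ x ∧
      x ≤ max (-c) (min c x) + max (|x| - c) 0 := by
    intro x
    rcases le_total x c with h1 | h1
    · rw [min_eq_right h1]
      rcases le_total (-c) x with h2 | h2
      · rw [max_eq_right h2]
        have := le_max_right (|x| - c) 0
        constructor <;> linarith
      · rw [max_eq_left h2]
        have := le_max_left (|x| - c) 0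
        have := le_max_right (|x| - c) 0
        have := neg_abs_le x
        constructor <;> linarith
    · rw [min_eq_left h1, max_eq_right (by linarith)]
      have := le_max_left (|x| - c) 0
      have := le_max_right (|x| - c) 0
      have := le_abs_self x
      constructor <;> linarith
  have fg := hg.finiteMean (h.mem 0)
  have hm : S.ev (X 0) ≤ S.ev (fun ω => max (-c) (min c (X 0 ω))) + δ :=
    ((ev_mono h.finiteMean_zero (fg.add hf) fun ω => (hpt _).2).trans (ev_add_le fg hf)).trans
      (by linarith)
  refine tendsto_cap_one_of_subset_union (h.tendsto_cap_mean_gt hg hδ0)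
    (h.cont.tendsto_cap_not (fun n => ?_) hU) ?_
  · refine measurableSet_le (Finset.measurable_sum _ fun i _ => ?_) measurable_const
    exact ((continuous_abs.measurable.comp (h.measurable i)).sub_const c).max measurable_const
  · filter_upwards [eventually_gt_atTop 0] with n hn ω hω
    by_cases hW : ∑ i ∈ Finset.range n, max (|X i ω| - c) 0 ≤ n * (2 * δ)
    · left
      have hn0 : (0 : ℝ) < n := by exact_mod_cast hn
      have h1 := (lt_div_iff₀ hn0).1 hω
      have h2 : ∑ i ∈ Finset.range n, max (-c) (min c (X i ω)) -
          ∑ i ∈ Finset.range n, max (|X i ω| - c) 0 ≤ partialSum X n ω := by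
        rw [← Finset.sum_sub_distrib]
        exact Finset.sum_le_sum fun i _ => (hpt _).1
      have h3 : (n : ℝ) * (S.ev (X 0) - ε) ≤
          n * (S.ev (fun ω => max (-c) (min c (X 0 ω))) - δ - 2 * δ) :=
        mul_le_mul_of_nonneg_left (by linarith) hn0.le
      change (n : ℝ) * (S.ev (X 0) - ε) < partialSum X n ω
      linarith
    · exact Or.inr hW

end StrongLawSetting

end SubLinearExpectation

/-! ### Limits of means of deterministic sequences -/

/-- The means `s n / n` are asymptotically at most `b`. -/
def MeanUpperBound (s : ℕ → ℝ) (b : ℝ) : Prop :=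
  ∀ ε : ℝ, 0 < ε → ∀ᶠ n : ℕ in atTop, s n ≤ n * (b + ε)

/-- The means `s n / n` come close to `b` or exceed it infinitely often. -/
def MeanFrequentlyAbove (s : ℕ → ℝ) (b : ℝ) : Prop :=
  ∀ ε : ℝ, 0 < ε → ∃ᶠ n : ℕ in atTop, n * (b - ε) < s n

theorem MeanUpperBound.eventually_div_le {s : ℕ → ℝ} {b : ℝ} (h : MeanUpperBound s b) {ε : ℝ}
    (hε : 0 < ε) : ∀ᶠ n : ℕ in atTop, s n / n ≤ b + ε := by
  filter_upwards [h ε hε, eventually_gt_atTop 0] with n hn hn0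
  rwa [div_le_iff₀ (by exact_mod_cast hn0), mul_comm]

theorem MeanFrequentlyAbove.frequently_lt_div {s : ℕ → ℝ} {b : ℝ} (h : MeanFrequentlyAbove s b)
    {ε : ℝ} (hε : 0 < ε) : ∃ᶠ n : ℕ in atTop, b - ε < s n / n := by
  refine ((h ε hε).and_eventually (eventually_gt_atTop 0)).mono fun n hn => ?_
  rw [lt_div_iff₀ (by exact_mod_cast hn.2), mul_comm]
  exact hn.1

theorem limsup_mean_eq {s : ℕ → ℝ} {b : ℝ} (hu : MeanUpperBound s b)
    (hl : MeanFrequentlyAbove s b) :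
    limsup (fun n : ℕ => ((s n / n : ℝ) : EReal)) atTop = b := by
  apply le_antisymm
  · rw [← EReal.le_of_forall_lt_iff_le]
    intro z hz
    have hz' : 0 < z - b := sub_pos.2 (EReal.coe_lt_coe_iff.1 hz)
    refine limsup_le_of_le (by isBoundedDefault) ((hu.eventually_div_le hz').mono fun n hn => ?_)
    exact EReal.coe_le_coe_iff.2 (hn.trans (by linarith))
  · rw [← EReal.ge_of_forall_gt_iff_ge]
    intro z hz
    have hz' : 0 < b - z := sub_pos.2 (EReal.coe_lt_coe_iff.1 hz)
    refine le_limsup_of_frequently_le ((hl.frequently_lt_div hz').mono fun n hn => ?_)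
      (by isBoundedDefault)
    exact EReal.coe_le_coe_iff.2 (le_of_lt (lt_of_le_of_lt (by linarith) hn))

theorem liminf_mean_eq {s : ℕ → ℝ} {b : ℝ} (hu : MeanUpperBound (fun n => - s n) b)
    (hl : MeanFrequentlyAbove (fun n => - s n) b) :
    liminf (fun n : ℕ => ((s n / n : ℝ) : EReal)) atTop = -(b : EReal) := by
  have h1 := limsup_mean_eq hu hl
  have h2 : (fun n : ℕ => ((-s n / n : ℝ) : EReal)) =
      -(fun n : ℕ => ((s n / n : ℝ) : EReal)) := by
    ext n
    rw [neg_div, EReal.coe_neg, Pi.neg_apply]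
  rw [h2, EReal.limsup_neg] at h1
  rw [← h1, neg_neg]

/-- A sequence with vanishing increments cannot jump over a point between its lower and its
upper limit, hence clusters at each such point. -/
theorem clusterSet_eq_Icc {x : ℕ → ℝ} {a b : ℝ}
    (hstep : ∀ ε : ℝ, 0 < ε → ∀ᶠ n in atTop, |x (n + 1) - x n| < ε)
    (ha : ∀ ε : ℝ, 0 < ε → ∀ᶠ n in atTop, a - ε ≤ x n)
    (ha' : ∀ ε : ℝ, 0 < ε → ∃ᶠ n in atTop, x n < a + ε)
    (hb : ∀ ε : ℝ, 0 < ε → ∀ᶠ n in atTop, x n ≤ b + ε)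
    (hb' : ∀ ε : ℝ, 0 < ε → ∃ᶠ n in atTop, b - ε < x n) :
    clusterSet x = Set.Icc a b := by
  ext p
  rw [clusterSet, Set.mem_Icc]
  change MapClusterPt p atTop x ↔ _
  rw [mapClusterPt_iff_frequently]
  constructor
  · intro hp
    constructor
    · by_contra! hpa
      have h1 := hp _ (Iio_mem_nhds (show p < (p + a) / 2 by linarith))
      obtain ⟨n, hn1, hn2⟩ := (h1.and_eventually (ha ((a - p) / 2) (by linarith))).exists
      have hn1' : x n < (p + a) / 2 := hn1
      linarith
    · by_contra! hpb
      have h1 := hp _ (Ioi_mem_nhds (show (p + b) / 2 < p by linarith))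
      obtain ⟨n, hn1, hn2⟩ := (h1.and_eventually (hb ((p - b) / 2) (by linarith))).exists
      have hn1' : (p + b) / 2 < x n := hn1
      linarith
  · rintro ⟨hap, hpb⟩ s hs
    obtain ⟨ε, hε, hball⟩ := Metric.mem_nhds_iff.1 hs
    by_contra hcon
    have hfar : ∀ᶠ n in atTop, ε ≤ |x n - p| := (not_frequently.1 hcon).mono fun n hn => by
      by_contra! hlt
      exact hn (hball (by rwa [Metric.mem_ball, Real.dist_eq]))
    obtain ⟨N, hN⟩ := eventually_atTop.1 (hfar.and (hstep ε hε))
    obtain ⟨n₁, hn₁, hx₁⟩ := frequently_atTop.1 (ha' ε hε) N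
    -- once below the forbidden interval around `p`, the sequence stays below it
    have hbelow : ∀ n, n₁ ≤ n → x n ≤ p - ε := by
      intro n hn
      induction n, hn using Nat.le_induction with
      | base =>
        have := (hN n₁ hn₁).1
        rcases le_abs.1 this with h | h <;> linarith
      | succ n hn ih =>
        have h1 := (abs_lt.1 (hN n (hn₁.trans hn)).2).2
        rcases le_abs.1 (hN (n + 1) (by omega)).1 with h | h <;> linarith
    obtain ⟨n₂, hn₂, hx₂⟩ := frequently_atTop.1 (hb' ε hε) n₁
    linarith [hbelow n₂ hn₂]

theorem clusterSet_mean_eq {s : ℕ → ℝ} {a b : ℝ}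
    (hstep : ∀ ε : ℝ, 0 < ε → ∀ᶠ n : ℕ in atTop, |s (n + 1) - s n| ≤ (n + 1) * ε)
    (hu : MeanUpperBound s b) (hl : MeanFrequentlyAbove s b)
    (hu' : MeanUpperBound (fun n => - s n) a) (hl' : MeanFrequentlyAbove (fun n => - s n) a) :
    clusterSet (fun n : ℕ => s n / n) = Set.Icc (-a) b := by
  refine clusterSet_eq_Icc (fun ε hε => ?_) (fun ε hε => ?_) (fun ε hε => ?_)
    (fun ε hε => hu.eventually_div_le hε) fun ε hε => hl.frequently_lt_div hε
  · have h1 : Tendsto (fun n : ℕ => ((n : ℝ) + 1) * (ε / 3)) atTop atTop :=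
      (tendsto_atTop_add_const_right _ _ tendsto_natCast_atTop_atTop).atTop_mul_const
        (by positivity)
    filter_upwards [hstep (ε / 3) (by positivity), hu.eventually_div_le one_pos,
      hu'.eventually_div_le one_pos, h1.eventually_ge_atTop (|a| + |b| + 1),
      eventually_gt_atTop 0] with n h2 h3 h4 h5 hn
    have hn0 : (0 : ℝ) < n := by exact_mod_cast hn
    have hn1 : (0 : ℝ) < n + 1 := by positivity
    have h6 : |s n / n| ≤ |a| + |b| + 1 := by
      rw [neg_div] at h4
      refine abs_le.2 ⟨?_, ?_⟩ <;>
      linarith [le_abs_self a, le_abs_self b, abs_nonneg a, abs_nonneg b]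
    have h7 : s (n + 1) / ((n + 1 : ℕ) : ℝ) - s n / n =
        (s (n + 1) - s n - s n / n) / (n + 1) := by
      push_cast
      field_simp
      ring
    rw [h7, abs_div, abs_of_pos hn1, div_lt_iff₀ hn1]
    have h8 := abs_sub (s (n + 1) - s n) (s n / n)
    nlinarith
  · filter_upwards [hu'.eventually_div_le hε] with n hn
    rw [neg_div] at hn
    linarith
  · refine (hl'.frequently_lt_div hε).mono fun n hn => ?_
    rw [neg_div] at hn
    linarith

theorem partialSum_neg {Ω : Type*} (X : ℕ → Ω → ℝ) (n : ℕ) (ω : Ω) :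
    partialSum (fun i ω => - X i ω) n ω = - partialSum X n ω := by
  simp [partialSum]

namespace SubLinearExpectation

variable {Ω : Type*} [MeasurableSpace Ω] {S : SubLinearExpectation Ω}

/-! ### The strong law -/

/-- The cut-off `x ↦ ramp (2 / (ε * N) * x + (2 - 2 * θ / ε))` lies between the indicators of
`x ≥ N * (θ - ε / 2)` and `x > N * (θ - ε)`. -/
theorem ramp_cutoff_eq_one {θ ε N x : ℝ} (hε : 0 < ε) (hN : 0 < N) (hx : N * (θ - ε / 2) ≤ x) :
    ramp (2 / (ε * N) * x + (2 - 2 * θ / ε)) = 1 := by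
  refine ramp_of_one_le ?_
  have h1 : 2 / (ε * N) * (N * (θ - ε / 2)) ≤ 2 / (ε * N) * x := by gcongr
  have h2 : 2 / (ε * N) * (N * (θ - ε / 2)) = 2 * θ / ε - 1 := by field_simp
  linarith

theorem ramp_cutoff_eq_zero {θ ε N x : ℝ} (hε : 0 < ε) (hN : 0 < N) (hx : x ≤ N * (θ - ε)) :
    ramp (2 / (ε * N) * x + (2 - 2 * θ / ε)) = 0 := by
  refine ramp_of_nonpos ?_
  have h1 : 2 / (ε * N) * x ≤ 2 / (ε * N) * (N * (θ - ε)) := by gcongr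
  have h2 : 2 / (ε * N) * (N * (θ - ε)) = 2 * θ / ε - 2 := by field_simp
  linarith

/-- If for each `ε > 0` the events `p ε n`, increasing in `ε`, occur infinitely often with
full capacity, then so they do simultaneously for all `ε > 0`. -/
theorem CapacityContinuous.cap_forall_frequently_eq_one (hc : S.CapacityContinuous)
    {p : ℝ → ℕ → Ω → Prop} (hp : ∀ ε n, MeasurableSet {ω | p ε n ω})
    (hmono : ∀ ε ε' n ω, ε ≤ ε' → p ε n ω → p ε' n ω)
    (h : ∀ ε : ℝ, 0 < ε → S.cap {ω | ∃ᶠ n in atTop, p ε n ω} = 1) :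
    S.cap {ω | ∀ ε : ℝ, 0 < ε → ∃ᶠ n in atTop, p ε n ω} = 1 := by
  have h1 : {ω | ∀ ε : ℝ, 0 < ε → ∃ᶠ n in atTop, p ε n ω} =
      ⋂ j : ℕ, {ω | ∃ᶠ n in atTop, p (1 / ((j : ℝ) + 1)) n ω} := by
    ext ω
    refine ⟨fun hω => Set.mem_iInter.2 fun j => hω _ (by positivity), fun hω ε hε => ?_⟩
    obtain ⟨j, hj⟩ := exists_nat_one_div_lt hε
    exact (show ∃ᶠ n in atTop, p (1 / ((j : ℝ) + 1)) n ω from Set.mem_iInter.1 hω j).mono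
      fun n hn => hmono _ _ _ _ hj.le hn
  rw [h1]
  refine hc.cap_iInter_eq_one (fun j => measurableSet_frequently (hp _)) (fun i j hij ω hω => ?_)
    fun j => h _ (by positivity)
  refine (show ∃ᶠ n in atTop, p (1 / ((j : ℝ) + 1)) n ω from hω).mono fun n hn =>
    hmono _ _ _ _ ?_ hn
  gcongr

/-- If for each `ε > 0` the events `p ε n`, increasing in `ε`, eventually occur up to a set of
capacity zero, then so they do simultaneously for all `ε > 0`. -/
theorem CapacityContinuous.cap_not_forall_eventually_eq_zero (hc : S.CapacityContinuous)
    {p : ℝ → ℕ → Ω → Prop} (hp : ∀ ε n, MeasurableSet {ω | p ε n ω})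
    (hmono : ∀ ε ε' n ω, ε ≤ ε' → p ε n ω → p ε' n ω)
    (h : ∀ ε : ℝ, 0 < ε → S.cap {ω | ¬ ∀ᶠ n in atTop, p ε n ω} = 0) :
    S.cap {ω | ¬ ∀ ε : ℝ, 0 < ε → ∀ᶠ n in atTop, p ε n ω} = 0 := by
  refine cap_eq_zero_of_subset (hc.cap_iUnion_eq_zero
    (A := fun j : ℕ => {ω | ¬ ∀ᶠ n in atTop, p (1 / ((j : ℝ) + 1)) n ω})
    (fun j => (measurableSet_eventually (hp _)).compl) fun j => h _ (by positivity)) fun ω hω => ?_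
  by_contra hcon
  refine hω fun ε hε => ?_
  obtain ⟨j, hj⟩ := exists_nat_one_div_lt hε
  have h1 : ∀ᶠ n in atTop, p (1 / ((j : ℝ) + 1)) n ω := by
    by_contra h2
    exact hcon (Set.mem_iUnion.2 ⟨j, h2⟩)
  exact h1.mono fun n hn => hmono _ _ _ _ hj.le hn

namespace StrongLawSetting

variable {X : ℕ → Ω → ℝ} (h : StrongLawSetting S X)

include h

theorem cap_not_meanUpperBound :
    S.cap {ω | ¬ MeanUpperBound (fun n => partialSum X n ω) (S.ev (X 0))} = 0 :=
  h.cont.cap_not_forall_eventually_eq_zero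
    (p := fun ε n ω => partialSum X n ω ≤ n * (S.ev (X 0) + ε))
    (fun ε n => measurableSet_le (h.measurable_partialSum n) measurable_const)
    (fun ε ε' n ω hεε' hn => hn.trans (by gcongr))
    fun ε hε => h.cap_not_eventually_partialSum_le hε

theorem cap_meanFrequentlyAbove :
    S.cap {ω | MeanFrequentlyAbove (fun n => partialSum X n ω) (S.ev (X 0))} = 1 := by
  have hm : ∀ (ε : ℝ) (n : ℕ), MeasurableSet {ω | n * (S.ev (X 0) - ε) < partialSum X n ω} :=
    fun ε n => measurableSet_lt measurable_const (h.measurable_partialSum n)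
  exact h.cont.cap_forall_frequently_eq_one
    (p := fun ε n ω => n * (S.ev (X 0) - ε) < partialSum X n ω) hm
    (fun ε ε' n ω hεε' hn => lt_of_le_of_lt (by gcongr) hn)
    fun ε hε => h.cont.cap_frequently_eq_one (hm ε) (h.tendsto_cap_partialSum_gt hε)

/-- Outside a set of capacity zero, `X n / n → 0`. -/
theorem cap_not_increments_small :
    S.cap {ω | ¬ ∀ ε : ℝ, 0 < ε → ∀ᶠ n : ℕ in atTop, |X n ω| ≤ (n + 1) * ε} = 0 :=
  h.cont.cap_not_forall_eventually_eq_zero (p := fun ε n ω => |X n ω| ≤ (n + 1) * ε)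
    (fun ε n => measurableSet_le (continuous_abs.measurable.comp (h.measurable n))
      measurable_const)
    (fun ε ε' n ω hεε' hn => hn.trans (by gcongr))
    fun ε hε => h.cap_not_eventually_abs_le hε

theorem cap_limsup_eq : S.cap {ω | limsup (fun n : ℕ => ((partialSum X n ω / n : ℝ) : EReal)) atTop
    = S.E (X 0)} = 1 := by
  refine cap_eq_one_of_subset_union h.cap_meanFrequentlyAbove h.cap_not_meanUpperBound
    fun ω hω => ?_
  by_cases hu : MeanUpperBound (fun n => partialSum X n ω) (S.ev (X 0))
  · exact Or.inl ((limsup_mean_eq hu hω).trans h.finiteMean_zero.coe_ev)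
  · exact Or.inr hu

theorem coe_ev_neg : -((S.ev (fun ω => - X 0 ω) : ℝ) : EReal) = S.conjE (X 0) := by
  rw [conjE, h.finiteMean_zero.neg.coe_ev]

theorem cap_not_meanUpperBound_neg : S.cap {ω | ¬ MeanUpperBound (fun n => - partialSum X n ω)
    (S.ev (fun ω => - X 0 ω))} = 0 := by
  simpa only [partialSum_neg] using h.neg.cap_not_meanUpperBound

theorem cap_liminf_eq : S.cap {ω | liminf (fun n : ℕ => ((partialSum X n ω / n : ℝ) : EReal)) atTop
    = S.conjE (X 0)} = 1 := by
  have hl := h.neg.cap_meanFrequentlyAbove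
  simp only [partialSum_neg] at hl
  refine cap_eq_one_of_subset_union hl h.cap_not_meanUpperBound_neg fun ω hω => ?_
  by_cases hu : MeanUpperBound (fun n => - partialSum X n ω) (S.ev (fun ω => - X 0 ω))
  · exact Or.inl ((liminf_mean_eq hu hω).trans h.coe_ev_neg)
  · exact Or.inr hu

theorem tendsto_cap_partialSum_gt_zero :
    Tendsto (fun n : ℕ => S.cap {ω | n * (S.ev (X 0) + 1) < partialSum X n ω}) atTop (𝓝 0) := by
  have := h.cont.tendsto_cap_not
    (fun n => measurableSet_le (h.measurable_partialSum n) measurable_const)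
    (h.cap_not_eventually_partialSum_le one_pos)
  simpa only [not_le] using this

section Blocks

variable {nk : ℕ → ℕ} (hnk : Tendsto nk atTop atTop)
  (hratio : Tendsto (fun k : ℕ => (nk k : ℝ) / (nk (k + 1) : ℝ)) atTop (𝓝 0))
  (hpair : ∀ k : ℕ, S.ExtIndepPair (partialSum X (nk k))
    (fun ω => partialSum X (nk (k + 1)) ω - partialSum X (nk k) ω))

omit h

include hnk hratio

theorem eventually_mul_le_mul_succ (C : ℝ) {ε : ℝ} (hε : 0 < ε) :
    ∀ᶠ k : ℕ in atTop, (nk k : ℝ) * C ≤ nk (k + 1) * ε := by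
  have h1 := hratio.mul_const C
  rw [zero_mul] at h1
  filter_upwards [h1.eventually_lt_const hε,
    (hnk.comp (tendsto_add_atTop_nat 1)).eventually_gt_atTop 0] with k hk hk0
  have hk0' : (0 : ℝ) < nk (k + 1) := by exact_mod_cast hk0
  rw [div_mul_eq_mul_div, div_lt_iff₀ hk0'] at hk
  linarith

include h hpair

/-- With capacity tending to `1`, the mean at the end of one block is almost as small as possible
and the mean at the end of the following, much longer block is almost as large as possible. -/
theorem tendsto_cap_blocks {ε : ℝ} (hε : 0 < ε) :
    Tendsto (fun k : ℕ => S.cap {ω |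
      nk k * (S.ev (fun ω => - X 0 ω) - ε) < - partialSum X (nk k) ω ∧
      nk (k + 1) * (S.ev (X 0) - ε) < partialSum X (nk (k + 1)) ω}) atTop (𝓝 1) := by
  set μ := S.ev (X 0) with hμ
  set μ' := S.ev (fun ω => - X 0 ω) with hμ'
  set δ := ε / 2 with hδ
  have hδ0 : 0 < δ := half_pos hε
  have hnk' : Tendsto (fun k => nk (k + 1)) atTop atTop := hnk.comp (tendsto_add_atTop_nat 1)
  have hlow : Tendsto (fun k : ℕ => S.cap {ω | nk k * (μ' - δ / 2) < - partialSum X (nk k) ω})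
      atTop (𝓝 1) := by
    have := (h.neg.tendsto_cap_partialSum_gt (half_pos hδ0)).comp hnk
    simp only [partialSum_neg] at this
    exact this
  have hblock : Tendsto (fun k : ℕ => S.cap {ω | nk (k + 1) * (μ - δ / 2) <
      partialSum X (nk (k + 1)) ω - partialSum X (nk k) ω}) atTop (𝓝 1) := by
    refine tendsto_cap_one_of_subset_union
      ((h.tendsto_cap_partialSum_gt (half_pos (half_pos hδ0))).comp hnk')
      (h.tendsto_cap_partialSum_gt_zero.comp hnk) ?_
    filter_upwards [eventually_mul_le_mul_succ hnk hratio (μ + 1) (half_pos (half_pos hδ0))]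
      with k hk ω hω
    have hω' : nk (k + 1) * (μ - δ / 2 / 2) < partialSum X (nk (k + 1)) ω := hω
    by_cases hb : nk k * (μ + 1) < partialSum X (nk k) ω
    · exact Or.inr hb
    · refine Or.inl ?_
      change nk (k + 1) * (μ - δ / 2) < partialSum X (nk (k + 1)) ω - partialSum X (nk k) ω
      have h1 : (nk (k + 1) : ℝ) * (μ - δ / 2) =
        nk (k + 1) * (μ - δ / 2 / 2) - nk (k + 1) * (δ / 2 / 2) := by ring
      linarith [not_lt.1 hb]
  have hboth : Tendsto (fun k : ℕ => S.cap {ω | nk k * (μ' - δ) < - partialSum X (nk k) ω ∧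
      nk (k + 1) * (μ - δ) < partialSum X (nk (k + 1)) ω - partialSum X (nk k) ω})
      atTop (𝓝 1) := by
    -- the product formula for cut-offs that lie between the indicators at levels `δ / 2` and `δ`
    have hprod := hlow.mul hblock
    rw [mul_one] at hprod
    refine tendsto_of_tendsto_of_tendsto_of_le_of_le' hprod tendsto_const_nhds ?_
      (Eventually.of_forall fun k => S.cap_le_one _)
    filter_upwards [hnk.eventually_gt_atTop 0, hnk'.eventually_gt_atTop 0] with k hk hk'
    have hk0 : (0 : ℝ) < nk k := by exact_mod_cast hk
    have hk0' : (0 : ℝ) < nk (k + 1) := by exact_mod_cast hk'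
    set φ : ℝ → ℝ := fun x => ramp (2 / (δ * nk k) * (-x) + (2 - 2 * μ' / δ)) with hφ
    set ψ : ℝ → ℝ := fun x => ramp (2 / (δ * nk (k + 1)) * x + (2 - 2 * μ / δ)) with hψ
    have bφ : BddLip φ := (LipschitzWith.id (α := ℝ)).neg.bddLip_ramp _ _
    have bψ : BddLip ψ := (LipschitzWith.id (α := ℝ)).bddLip_ramp _ _
    have mY := partialSum_mem h.mem (nk k)
    have mZ : (fun ω => partialSum X (nk (k + 1)) ω - partialSum X (nk k) ω) ∈ S.H :=
      S.H.sub_mem (partialSum_mem h.mem _) mY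
    have hY : S.cap {ω | nk k * (μ' - δ / 2) < - partialSum X (nk k) ω} ≤
        S.ev (fun ω => φ (partialSum X (nk k) ω)) :=
      cap_le_ev (bφ.finiteMean mY) (fun ω => ramp_nonneg _) fun ω hω =>
        (ramp_cutoff_eq_one hδ0 hk0 (le_of_lt hω)).ge
    have hZ : S.cap {ω | nk (k + 1) * (μ - δ / 2) <
        partialSum X (nk (k + 1)) ω - partialSum X (nk k) ω} ≤
        S.ev (fun ω => ψ (partialSum X (nk (k + 1)) ω - partialSum X (nk k) ω)) :=
      cap_le_ev (bψ.finiteMean mZ) (fun ω => ramp_nonneg _) fun ω hω =>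
        (ramp_cutoff_eq_one hδ0 hk0' (le_of_lt hω)).ge
    refine (mul_le_mul hY hZ (S.cap_nonneg _) ((S.cap_nonneg _).trans hY)).trans ?_
    rw [← (hpair k).ev_mul mY mZ bφ bψ (fun _ => ramp_nonneg _) fun _ => ramp_nonneg _]
    refine ev_le_cap (finiteMean_of_mem_unitInterval
      (mul_mem (comp_mem_one mY bφ.locLip) (comp_mem_one mZ bψ.locLip))
      (fun ω => mul_nonneg (ramp_nonneg _) (ramp_nonneg _))
      (fun ω => mul_le_one₀ (ramp_le_one _) (ramp_nonneg _) (ramp_le_one _)))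
      (fun ω => mul_le_one₀ (ramp_le_one _) (ramp_nonneg _) (ramp_le_one _)) fun ω hω => ?_
    rcases not_and_or.1 hω with hω | hω
    · exact (mul_eq_zero_of_left (ramp_cutoff_eq_zero hδ0 hk0 (not_lt.1 hω)) _).le
    · exact (mul_eq_zero_of_right _ (ramp_cutoff_eq_zero hδ0 hk0' (not_lt.1 hω))).le
  have hsmall : Tendsto (fun k : ℕ => S.cap {ω | nk k * (μ' + 1) < - partialSum X (nk k) ω})
      atTop (𝓝 0) := by
    have := h.neg.tendsto_cap_partialSum_gt_zero.comp hnk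
    simp only [partialSum_neg] at this
    exact this
  refine tendsto_cap_one_of_subset_union hboth hsmall ?_
  filter_upwards [eventually_mul_le_mul_succ hnk hratio (μ' + 1) hδ0] with k hk ω hω
  by_cases hb : nk k * (μ' + 1) < - partialSum X (nk k) ω
  · exact Or.inr hb
  · refine Or.inl ⟨lt_of_le_of_lt ?_ hω.1, ?_⟩
    · have : μ' - ε ≤ μ' - δ := by linarith
      gcongr
    · have h1 : (nk (k + 1) : ℝ) * (μ - ε) = nk (k + 1) * (μ - δ) - nk (k + 1) * δ := by
        rw [hδ]; ring
      linarith [not_lt.1 hb, hω.2]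

theorem cap_meanFrequentlyAbove_both :
    S.cap {ω | MeanFrequentlyAbove (fun n => - partialSum X n ω) (S.ev (fun ω => - X 0 ω)) ∧
      MeanFrequentlyAbove (fun n => partialSum X n ω) (S.ev (X 0))} = 1 := by
  have hm : ∀ (ε : ℝ) (k : ℕ), MeasurableSet {ω |
      nk k * (S.ev (fun ω => - X 0 ω) - ε) < - partialSum X (nk k) ω ∧
      nk (k + 1) * (S.ev (X 0) - ε) < partialSum X (nk (k + 1)) ω} := fun ε k =>
    (measurableSet_lt measurable_const (h.measurable_partialSum _).neg).inter
      (measurableSet_lt measurable_const (h.measurable_partialSum _))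
  have h1 := h.cont.cap_forall_frequently_eq_one hm
    (fun ε ε' k ω hεε' hk => ⟨lt_of_le_of_lt (by gcongr) hk.1, lt_of_le_of_lt (by gcongr) hk.2⟩)
    fun ε hε => h.cont.cap_frequently_eq_one (hm ε)
      (h.tendsto_cap_blocks hnk hratio hpair hε)
  refine le_antisymm (S.cap_le_one _) (h1.ge.trans (cap_mono fun ω hω => ⟨fun ε hε => ?_,
    fun ε hε => ?_⟩))
  · exact hnk.frequently ((hω ε hε).mono fun k hk => hk.1)
  · exact (hnk.comp (tendsto_add_atTop_nat 1)).frequently ((hω ε hε).mono fun k hk => hk.2)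

theorem cap_liminf_limsup_eq : S.cap {ω |
    liminf (fun n : ℕ => ((partialSum X n ω / n : ℝ) : EReal)) atTop = S.conjE (X 0) ∧
    limsup (fun n : ℕ => ((partialSum X n ω / n : ℝ) : EReal)) atTop = S.E (X 0)} = 1 := by
  refine cap_eq_one_of_subset_union (h.cap_meanFrequentlyAbove_both hnk hratio hpair)
    (cap_union_eq_zero h.cap_not_meanUpperBound_neg h.cap_not_meanUpperBound) fun ω hω => ?_
  by_cases hN : ω ∈ {ω | ¬ MeanUpperBound (fun n => - partialSum X n ω)
      (S.ev (fun ω => - X 0 ω))} ∪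
      {ω | ¬ MeanUpperBound (fun n => partialSum X n ω) (S.ev (X 0))}
  · exact Or.inr hN
  · obtain ⟨hN1, hN2⟩ := not_or.1 hN
    exact Or.inl ⟨(liminf_mean_eq (not_not.1 hN1) hω.1).trans h.coe_ev_neg,
      (limsup_mean_eq (not_not.1 hN2) hω.2).trans h.finiteMean_zero.coe_ev⟩

theorem cap_clusterSet_eq : S.cap {ω | clusterSet (fun n : ℕ => partialSum X n ω / n)
    = {x : ℝ | S.conjE (X 0) ≤ (x : EReal) ∧ (x : EReal) ≤ S.E (X 0)}} = 1 := by
  refine cap_eq_one_of_subset_union (h.cap_meanFrequentlyAbove_both hnk hratio hpair)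
    (cap_union_eq_zero h.cap_not_increments_small
      (cap_union_eq_zero h.cap_not_meanUpperBound_neg h.cap_not_meanUpperBound)) fun ω hω => ?_
  by_cases hN : ω ∈ {ω | ¬ ∀ ε : ℝ, 0 < ε → ∀ᶠ n : ℕ in atTop, |X n ω| ≤ (n + 1) * ε} ∪
      ({ω | ¬ MeanUpperBound (fun n => - partialSum X n ω) (S.ev (fun ω => - X 0 ω))} ∪
      {ω | ¬ MeanUpperBound (fun n => partialSum X n ω) (S.ev (X 0))})
  · exact Or.inr hN
  · obtain ⟨hN0, hN'⟩ := not_or.1 hN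
    obtain ⟨hN1, hN2⟩ := not_or.1 hN'
    have hstep : ∀ ε : ℝ, 0 < ε → ∀ᶠ n : ℕ in atTop,
        |partialSum X (n + 1) ω - partialSum X n ω| ≤ (n + 1) * ε := fun ε hε => by
      simpa only [partialSum, Finset.sum_range_succ, add_sub_cancel_left] using
        not_not.1 hN0 ε hε
    have h1 := clusterSet_mean_eq hstep (not_not.1 hN2) hω.2 (not_not.1 hN1) hω.1
    refine Or.inl (h1.trans ?_)
    ext x
    change _ ↔ S.conjE (X 0) ≤ (x : EReal) ∧ (x : EReal) ≤ S.E (X 0)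
    rw [← h.coe_ev_neg, ← h.finiteMean_zero.coe_ev, ← EReal.coe_neg, EReal.coe_le_coe_iff,
      EReal.coe_le_coe_iff, Set.mem_Icc]

end Blocks

end StrongLawSetting

theorem capacity_eq_one_iff {A : Set Ω} : S.capacity A = 1 ↔ S.cap A = 1 := by
  rw [← S.coe_cap, ← EReal.coe_one, EReal.coe_eq_coe_iff]

end SubLinearExpectation

theorem mainTheorem5 {Ω : Type*} [MeasurableSpace Ω] (S : SubLinearExpectation Ω)
    (X : ℕ → Ω → ℝ) (hX : ∀ n, X n ∈ S.H)
    (hindep : S.ExtIndep X)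
    (hident : ∀ n, S.IdentDist (X n) (X 0))
    (hchoquet : S.choquet (fun ω => |X 0 ω|) < ⊤)
    (hui : Tendsto (fun c : ℝ => S.E (fun ω => max (|X 0 ω| - c) 0)) atTop (𝓝 0))
    (hcont : S.CapacityContinuous) :
    S.capacity {ω | liminf (fun n : ℕ => ((partialSum X n ω / n : ℝ) : EReal)) atTop
        = S.conjE (X 0)} = 1 ∧
    S.capacity {ω | limsup (fun n : ℕ => ((partialSum X n ω / n : ℝ) : EReal)) atTop
        = S.E (X 0)} = 1 ∧
    ∀ nk : ℕ → ℕ, Tendsto nk atTop atTop →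
      Tendsto (fun k : ℕ => (nk k : ℝ) / (nk (k + 1) : ℝ)) atTop (𝓝 0) →
      (∀ k : ℕ, S.ExtIndepPair (partialSum X (nk k))
        (fun ω => partialSum X (nk (k + 1)) ω - partialSum X (nk k) ω)) →
      S.capacity {ω |
          liminf (fun n : ℕ => ((partialSum X n ω / n : ℝ) : EReal)) atTop = S.conjE (X 0) ∧
          limsup (fun n : ℕ => ((partialSum X n ω / n : ℝ) : EReal)) atTop = S.E (X 0)} = 1 ∧
      S.capacity {ω | clusterSet (fun n : ℕ => partialSum X n ω / n)
          = {x : ℝ | S.conjE (X 0) ≤ (x : EReal) ∧ (x : EReal) ≤ S.E (X 0)}} = 1 := by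
  have h := SubLinearExpectation.strongLawSetting hX hindep hident hchoquet hui hcont
  simp only [SubLinearExpectation.capacity_eq_one_iff]
  exact ⟨h.cap_liminf_eq, h.cap_limsup_eq, fun nk hnk hratio hpair =>
    ⟨h.cap_liminf_limsup_eq hnk hratio hpair, h.cap_clusterSet_eq hnk hratio hpair⟩⟩
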